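/- Let $f(x,y)=y^{n}+a_{1}(x)y^{n-1}+\cdots+a_{n}(x)\in\mathbb{C}[x,y]$ with $n>1$ and $\deg a_i\le i$ for $i=1,\dots,n$, and let $\lambda_0\in\mathbb{C}$. For a function $\varphi$ meromorphic at $\infty$, $\deg\varphi$ denotes the largest exponent with nonzero coefficient in its Laurent expansion at $\infty$, with $\deg 0=-\infty$; for a mapping, $\deg$ is the maximum of the degrees of its components. Put $$\mathcal{L}_{\infty,\lambda_0}(f):=\inf_{\Phi}\frac{\deg(\nabla f\circ\Phi)}{\deg\Phi}\in[-\infty,+\infty),$$ where $\Phi=(\varphi_1,\varphi_2)$ runs over all mappings meromorphic at $\infty$ with $\deg\Phi>0$ and $\deg\,(f-\lambda_0)\circ\Phi<0$. For a polynomial mapping $F:\mathbb{C}^2\to\mathbb{C}^2$ let $\mathcal{L}_\infty(F)\in[-\infty,+\infty)$ be the supremum of all $\nu\in\mathbb{R}$ for which there are $A,B>0$ such that $|F(z)|\ge A|z|^{\nu}$ for all $z\in\mathbb{C}^2$ with $|z|>B$, where $|\cdot|$ is the maximum norm ($\mathcal{L}_\infty(F)=-\infty$ if there is no such $\nu$).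 Suppose that $\mathcal{L}_{\infty}(f-\lambda_0,f_y')<0$. Let $D\ge 1$ be an integer and let $\beta_1,\dots,\beta_n$ be functions meromorphic at $\infty$ such that $$f(t^{D},y)-\lambda_0=\prod_{i=1}^{n}(y-\beta_i(t))$$ for all $y\in\mathbb{C}$ and all $t$ in a neighbourhood of $\infty$. Then $$\mathcal{L}_{\infty,\lambda_0}(f)+1=\frac1D\min_{i=1}^{n}\Bigl(\sum_{j=1,\,j\ne i}^{n}\deg(\beta_i-\beta_j)+\min_{j=1,\,j\ne i}^{n}\deg(\beta_i-\beta_j)\Bigr),$$ as an equality in $[-\infty,+\infty)$, with the usual conventions for $-\infty$. -/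

import Mathlib

/-- `φ` is meromorphic at the point `∞` of the Riemann sphere: `s ↦ φ (1 / s)` is meromorphic
at `0`. Only the values of `φ` for large `|t|` matter. -/
def MeromorphicAtInfty (φ : ℂ → ℂ) : Prop :=
  MeromorphicAt (fun s : ℂ => φ s⁻¹) 0

/-- The degree of a function meromorphic at infinity: the largest exponent with a nonzero
coefficient in its Laurent expansion at infinity, that is, minus the order of `s ↦ φ (1 / s)`
at `0`. The degree of the zero germ is `-∞`. -/
noncomputable def degInfty (φ : ℂ → ℂ) : EReal :=
  match meromorphicOrderAt (fun s : ℂ => φ s⁻¹) 0 with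
  | ⊤ => ⊥
  | (m : ℤ) => (((-m : ℤ) : ℝ) : EReal)

/-- The degree of a mapping: the maximum of the degrees of its components. -/
noncomputable def degInftyMap {k : ℕ} (Φ : ℂ → Fin k → ℂ) : EReal :=
  Finset.univ.sup fun i => degInfty fun t => Φ t i

/-- The gradient of a complex polynomial as a map `ℂᵏ → ℂᵏ`. -/
noncomputable def polyGrad {k : ℕ} (f : MvPolynomial (Fin k) ℂ) (z : Fin k → ℂ) : Fin k → ℂ :=
  fun i => MvPolynomial.eval z (MvPolynomial.pderiv i f)

/-- `Φ` is a meromorphic curve (at infinity) which is unbounded, and along which `f` tends to the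
value `lam`: `deg Φ > 0` and `deg (f - lam) ∘ Φ < 0`. -/
def IsCurveToFiber {k : ℕ} (f : MvPolynomial (Fin k) ℂ) (lam : ℂ) (Φ : ℂ → Fin k → ℂ) : Prop :=
  (∀ i, MeromorphicAtInfty fun t => Φ t i) ∧ 0 < degInftyMap Φ ∧
    degInfty (fun t => MvPolynomial.eval (Φ t) f - lam) < 0

/-- The Łojasiewicz exponent at infinity of the gradient of `f` near the fibre `f⁻¹(lam)`:
the infimum of `deg (∇f ∘ Φ) / deg Φ` over all meromorphic curves `Φ` with `deg Φ > 0` and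
`deg (f - lam) ∘ Φ < 0`. -/
noncomputable def lojasiewiczNearFiber {k : ℕ} (f : MvPolynomial (Fin k) ℂ) (lam : ℂ) : EReal :=
  ⨅ (Φ : ℂ → Fin k → ℂ) (_ : IsCurveToFiber f lam Φ),
    degInftyMap (fun t => polyGrad f (Φ t)) / degInftyMap Φ

/-- The set `N(F|S)` of exponents `ν` with `|F z| ≥ A |z| ^ ν` for all `z ∈ S` with `|z| > B`, for
some `A, B > 0`. The norm of `Fin k → ℂ` is the polycylindric (maximum) norm. -/
def lojasiewiczSet {k m : ℕ} (F : (Fin k → ℂ) → (Fin m → ℂ)) (S : Set (Fin k → ℂ)) : Set ℝ :=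
  {ν | ∃ A B : ℝ, 0 < A ∧ 0 < B ∧ ∀ z ∈ S, B < ‖z‖ → A * ‖z‖ ^ ν ≤ ‖F z‖}

/-- The Łojasiewicz exponent at infinity of `F` on `S`: the supremum of `N(F|S)`, and `-∞` if
`N(F|S)` is empty. -/
noncomputable def lojasiewiczExponent {k m : ℕ} (F : (Fin k → ℂ) → (Fin m → ℂ))
    (S : Set (Fin k → ℂ)) : EReal :=
  ⨆ ν ∈ lojasiewiczSet F S, (ν : EReal)

/-- `f(x, y) = yⁿ + a₁(x) yⁿ⁻¹ + ⋯ + aₙ(x)` with `deg aᵢ ≤ i`; the variable `x` is `X 0` and `y`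
is `X 1`. -/
def IsMonicForm (f : MvPolynomial (Fin 2) ℂ) (n : ℕ) : Prop :=
  ∃ a : ℕ → Polynomial ℂ, (∀ i ∈ Finset.Icc 1 n, (a i).natDegree ≤ i) ∧
    f = MvPolynomial.X 1 ^ n + ∑ i ∈ Finset.Icc 1 n,
      Polynomial.aeval (MvPolynomial.X 0 : MvPolynomial (Fin 2) ℂ) (a i) *
        MvPolynomial.X 1 ^ (n - i)

open Polynomial Filter Topology Bornology Asymptotics
open scoped ContDiff

/-! Write `e i j` for the degree of `β i - β j`, `m i` for the least `e i j` with `j ≠ i`, and `S i`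
for the sum of the `e i j` plus `m i`. The claim is that the exponent plus one equals `T / D`, where
`T` is the least `S i`.

Lower bound. With `x = t ^ D`, let `β i` be the root nearest to `y`. Either `y` is at distance at
least a constant times `|t| ^ m i` from it and `|f - lam|` is at least of order `|t| ^ S i`, or one
summand dominates `f_y`, which then has order at least `S i - m i`. Since `m i ≤ D`, both cases give
`|f - lam| + |x| |f_y| ≥ c |x| ^ (T / D)` (`exists_zpow_le_norm_add_pow`). Along a curve on which `f
- lam` has negative degree, differentiation lowers that degree by exactly one, so by the chain rule
it is at most `deg ∇f + deg Φ`. Hence `deg ∇f + deg Φ ≥ (T / D) deg Φ`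
(`le_degInftyMap_polyGrad_div`).

Upper bound. For `i` with `S i = T`, the coordinate `y = β i + t ^ m i * s` turns `f - lam` into `t
^ T * P_{1/t}(s)`. The limit `P_0` has a critical point with nonzero critical value, which
Newton–Puiseux continues to a branch of the polar curve `f_y = 0`. On it `f - lam` has order exactly
`T` in `t`, and the chain rule determines `f_x` (`exists_curve_degInftyMap_polyGrad_div_le`). This
branch leads to the fibre only if `T < 0`, which the negative exponent of `(f - lam, f_y)` ensures
(`lojasiewiczExponent_nonneg`). If two roots coincide, the gradient vanishes along them and both
sides are `-∞`. -/

/-! ### Polynomials with analytic coefficients. -/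

/-- A family of complex polynomials of bounded degree whose coefficients are analytic at `0`. -/
def AnalyticPolyFamily (H : ℂ → ℂ[X]) : Prop :=
  (∃ d : ℕ, ∀ τ, (H τ).natDegree ≤ d) ∧ ∀ k, AnalyticAt ℂ (fun τ => (H τ).coeff k) 0

namespace AnalyticPolyFamily

variable {H K : ℂ → ℂ[X]}

theorem const (p : ℂ[X]) : AnalyticPolyFamily fun _ => p :=
  ⟨⟨p.natDegree, fun _ => le_rfl⟩, fun _ => analyticAt_const⟩

theorem C_of_analyticAt {g : ℂ → ℂ} (hg : AnalyticAt ℂ g 0) :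
    AnalyticPolyFamily fun τ => C (g τ) := by
  refine ⟨⟨0, fun τ => by simp⟩, fun k => ?_⟩
  by_cases hk : k = 0
  · simpa [coeff_C, hk] using hg
  · simpa [coeff_C, hk] using analyticAt_const

theorem mul (hH : AnalyticPolyFamily H) (hK : AnalyticPolyFamily K) :
    AnalyticPolyFamily fun τ => H τ * K τ := by
  obtain ⟨⟨d, hd⟩, h⟩ := hH
  obtain ⟨⟨e, he⟩, k⟩ := hK
  refine ⟨⟨d + e, fun τ => natDegree_mul_le.trans (add_le_add (hd τ) (he τ))⟩, fun i => ?_⟩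
  simp only [coeff_mul]
  exact Finset.analyticAt_fun_sum _ fun x _ => (h x.1).mul (k x.2)

theorem prod {ι : Type*} (s : Finset ι) {H : ι → ℂ → ℂ[X]}
    (hH : ∀ i ∈ s, AnalyticPolyFamily (H i)) : AnalyticPolyFamily fun τ => ∏ i ∈ s, H i τ := by
  classical
  induction s using Finset.induction_on with
  | empty => simpa using const 1
  | insert a s ha ih =>
    simp only [Finset.prod_insert ha]
    exact (hH a (by simp)).mul (ih fun i hi => hH i (by simp [hi]))

theorem derivative (hH : AnalyticPolyFamily H) :
    AnalyticPolyFamily fun τ => Polynomial.derivative (H τ) := by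
  obtain ⟨⟨d, hd⟩, h⟩ := hH
  refine ⟨⟨d, fun τ => (natDegree_derivative_le _).trans ((Nat.sub_le _ _).trans (hd τ))⟩,
    fun i => ?_⟩
  simp only [coeff_derivative]
  exact (h _).mul analyticAt_const

theorem hasseDeriv (hH : AnalyticPolyFamily H) (m : ℕ) :
    AnalyticPolyFamily fun τ => Polynomial.hasseDeriv m (H τ) := by
  obtain ⟨⟨d, hd⟩, h⟩ := hH
  refine ⟨⟨d, fun τ => (natDegree_hasseDeriv_le _ _).trans ((Nat.sub_le _ _).trans (hd τ))⟩,
    fun i => ?_⟩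
  simp only [hasseDeriv_coeff]
  exact analyticAt_const.mul (h _)

theorem eval_eq (d : ℕ) (hd : ∀ τ, (H τ).natDegree ≤ d) (τ s : ℂ) :
    (H τ).eval s = ∑ k ∈ Finset.range (d + 1), (H τ).coeff k * s ^ k :=
  eval_eq_sum_range' (Nat.lt_succ_of_le (hd τ)) s

theorem analyticAt_eval (hH : AnalyticPolyFamily H) {σ : ℂ → ℂ} (hσ : AnalyticAt ℂ σ 0) :
    AnalyticAt ℂ (fun τ => (H τ).eval (σ τ)) 0 := by
  obtain ⟨⟨d, hd⟩, h⟩ := hH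
  simp only [eval_eq d hd]
  exact Finset.analyticAt_fun_sum _ fun k _ => (h k).mul (hσ.pow k)

theorem analyticAt_eval_prod (hH : AnalyticPolyFamily H) (s : ℂ) :
    AnalyticAt ℂ (fun z : ℂ × ℂ => (H z.1).eval z.2) (0, s) := by
  obtain ⟨⟨d, hd⟩, h⟩ := hH
  simp only [eval_eq d hd]
  refine Finset.analyticAt_fun_sum _ fun k _ => ?_
  have h1 : AnalyticAt ℂ (fun z : ℂ × ℂ => (H z.1).coeff k) (0, s) :=
    AnalyticAt.comp (g := fun τ => (H τ).coeff k) (f := Prod.fst) (h k) analyticAt_fst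
  exact h1.mul (analyticAt_snd.pow k)

theorem taylor (hH : AnalyticPolyFamily H) {σ : ℂ → ℂ} (hσ : AnalyticAt ℂ σ 0) :
    AnalyticPolyFamily fun τ => Polynomial.taylor (σ τ) (H τ) := by
  refine ⟨?_, fun k => ?_⟩
  · obtain ⟨⟨d, hd⟩, -⟩ := hH
    exact ⟨d, fun τ => by simpa using hd τ⟩
  · simp only [taylor_coeff]
    exact (hH.hasseDeriv k).analyticAt_eval hσ

/-- A simple root at `τ = 0` extends to an analytic root. -/
theorem exists_analytic_root (hH : AnalyticPolyFamily H) (h0 : (H 0).coeff 0 = 0)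
    (h1 : (H 0).coeff 1 ≠ 0) :
    ∃ σ : ℂ → ℂ, AnalyticAt ℂ σ 0 ∧ σ 0 = 0 ∧ ∀ᶠ τ in 𝓝 0, (H τ).eval (σ τ) = 0 := by
  set F : ℂ × ℂ → ℂ := fun z => (H z.1).eval z.2 with hF
  have ha : AnalyticAt ℂ F (0, 0) := hH.analyticAt_eval_prod 0
  have hc : ContDiffAt ℂ ω F (0, 0) := ha.contDiffAt
  have hd : HasDerivAt (fun s : ℂ => F (0, s)) ((H 0).coeff 1) 0 := by
    have := (H 0).hasDerivAt (0 : ℂ)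
    rwa [← coeff_zero_eq_eval_zero, coeff_derivative, Nat.cast_zero, zero_add, zero_add, mul_one]
      at this
  have hd' : HasDerivAt (fun s : ℂ => F (0, s))
      ((fderiv ℂ F (0, 0) ∘L .inr ℂ ℂ ℂ) 1) 0 := by
    have h2 : HasFDerivAt (fun s : ℂ => ((0 : ℂ), s)) (.inr ℂ ℂ ℂ) (0 : ℂ) :=
      hasFDerivAt_prodMk_right 0 0
    exact (ha.differentiableAt.hasFDerivAt.comp (0 : ℂ) h2).hasDerivAt
  have hval := hd'.unique hd
  have hinv : (fderiv ℂ F (0, 0) ∘L .inr ℂ ℂ ℂ).IsInvertible := by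
    refine ⟨ContinuousLinearEquiv.unitsEquivAut ℂ (Units.mk0 _ h1), ?_⟩
    ext
    simp [hval]
  refine ⟨hc.implicitFunction (by simp) hinv, ?_, hc.implicitFunction_apply_self (by simp) hinv, ?_⟩
  · exact (hc.contDiffAt_implicitFunction (by simp) hinv).analyticAt
  · filter_upwards [hc.eventually_apply_implicitFunction (by simp) hinv] with τ hτ
    have : F (0, 0) = 0 := by simpa [hF, ← coeff_zero_eq_eval_zero] using h0
    rw [this] at hτ
    exact hτ

end AnalyticPolyFamily

/-! ### The Newton–Puiseux theorem. -/

/-- A polynomial of degree `μ` without term of degree `μ - 1` which is not a monomial has a root of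
multiplicity less than `μ`. -/
theorem Polynomial.exists_rootMultiplicity_lt {R : ℂ[X]} {μ k : ℕ} (hdeg : ∀ j, μ < j → R.coeff j = 0)
    (hμ : R.coeff μ ≠ 0) (hsub : R.coeff (μ - 1) = 0) (hk : k < μ) (hRk : R.coeff k ≠ 0) :
    ∃ w, 0 < R.rootMultiplicity w ∧ R.rootMultiplicity w < μ := by
  have hR0 : R ≠ 0 := fun h => hμ (by simp [h])
  have hnat : R.natDegree = μ := natDegree_eq_of_le_of_coeff_ne_zero
    (natDegree_le_iff_coeff_eq_zero.2 hdeg) hμ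
  obtain ⟨w, hw⟩ := IsAlgClosed.exists_root R fun h => by
    rw [natDegree_eq_of_degree_eq_some h] at hnat
    have : μ = 0 := hnat.symm
    omega
  refine ⟨w, (rootMultiplicity_pos hR0).2 hw, ?_⟩
  by_contra! hge
  -- A root of multiplicity at least `μ` forces `R = a (X - w) ^ μ`. The vanishing coefficient of
  -- degree `μ - 1` gives `w = 0`, so `R` would be a monomial.
  obtain ⟨c, hc⟩ := (le_rootMultiplicity_iff hR0).1 hge
  have hc0 : c ≠ 0 := fun h => hR0 (by rw [hc, h, mul_zero])
  have hcn : c.natDegree = 0 := by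
    have := congrArg natDegree hc
    rw [natDegree_mul (pow_ne_zero _ (X_sub_C_ne_zero w)) hc0, natDegree_pow, natDegree_X_sub_C,
      hnat] at this
    omega
  obtain ⟨a, rfl⟩ : ∃ a, c = C a := ⟨_, eq_C_of_natDegree_eq_zero hcn⟩
  have ha : a ≠ 0 := fun h => hc0 (by simp [h])
  have hw0 : w = 0 := by
    rw [hc, coeff_mul_C, sub_eq_add_neg, ← C_neg, coeff_X_add_C_pow] at hsub
    have h1 : μ - (μ - 1) = 1 := by omega
    have h2 : (μ.choose (μ - 1) : ℂ) ≠ 0 := by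
      exact_mod_cast (Nat.choose_pos (Nat.sub_le _ _)).ne'
    simpa [h1, ha, h2] using hsub
  rw [hc, hw0] at hRk
  simp [coeff_X_pow, hk.ne] at hRk

theorem Filter.Tendsto.pow_nhds_zero {q : ℕ} (hq : 0 < q) :
    Tendsto (fun u : ℂ => u ^ q) (𝓝 0) (𝓝 0) := by
  have := (continuous_pow (M := ℂ) q).tendsto 0
  rwa [zero_pow hq.ne'] at this

namespace AnalyticPolyFamily

variable {H : ℂ → ℂ[X]}

/-- Separation of the lowest slope of the Newton polygon. -/
theorem exists_rescaling (hH : AnalyticPolyFamily H) {μ : ℕ}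
    (hlow : ∀ k < μ, (H 0).coeff k = 0) (hμ : (H 0).coeff μ ≠ 0)
    (hsub : ∀ᶠ τ in 𝓝 0, (H τ).coeff (μ - 1) = 0)
    (hne : ∃ k < μ, ¬ ∀ᶠ τ in 𝓝 0, (H τ).coeff k = 0) :
    ∃ (p q : ℕ) (K : ℂ → ℂ[X]), 0 < p ∧ 0 < q ∧ AnalyticPolyFamily K ∧
      (∀ᶠ u in 𝓝 0, ∀ w, u ^ (p * μ) * (K u).eval w = (H (u ^ q)).eval (u ^ p * w)) ∧
      (∀ j, μ < j → (K 0).coeff j = 0) ∧ (K 0).coeff μ ≠ 0 ∧ (K 0).coeff (μ - 1) = 0 ∧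
      ∃ k < μ, (K 0).coeff k ≠ 0 := by
  classical
  obtain ⟨⟨d, hd⟩, hcoef⟩ := id hH
  -- Below `μ`, `o k` is the order of vanishing of the `k`-th coefficient. From `μ` on it is set to
  -- `0`; for an identically zero coefficient it is a dummy, harmless because `g = 0`.
  have key : ∀ k, ∃ (o : ℕ) (g : ℂ → ℂ), AnalyticAt ℂ g 0 ∧
      (∀ᶠ τ in 𝓝 0, (H τ).coeff k = τ ^ o * g τ) ∧ (μ ≤ k → o = 0 ∧ g 0 = (H 0).coeff k) ∧
      (k < μ → (∀ᶠ τ in 𝓝 0, (H τ).coeff k = 0) → g = 0) ∧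
      (k < μ → (¬ ∀ᶠ τ in 𝓝 0, (H τ).coeff k = 0) → g 0 ≠ 0) := by
    intro k
    by_cases hk : μ ≤ k
    · exact ⟨0, _, hcoef k, by simp, fun _ => ⟨rfl, rfl⟩, fun h => by omega, fun h => by omega⟩
    by_cases hz : ∀ᶠ τ in 𝓝 0, (H τ).coeff k = 0
    · exact ⟨0, 0, analyticAt_const, by simpa using hz, fun h => by omega, fun _ _ => rfl,
        fun _ h => (h hz).elim⟩
    · obtain ⟨o, g, hg, hg0, he⟩ := (hcoef k).exists_eventuallyEq_pow_smul_nonzero_iff.2 hz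
      exact ⟨o, g, hg, by simpa using he, fun h => by omega, fun _ h => (hz h).elim, fun _ _ => hg0⟩
  choose o g hg hfac hhigh hzero hnz using key
  set Z := (Finset.range μ).filter fun k => ¬ ∀ᶠ τ in 𝓝 0, (H τ).coeff k = 0 with hZ
  have hZne : Z.Nonempty := by
    obtain ⟨k, hk, h⟩ := hne
    exact ⟨k, Finset.mem_filter.2 ⟨Finset.mem_range.2 hk, h⟩⟩
  -- The minimal slope `o l / (μ - l) = p / q` dictates the substitution `τ = u ^ q`, `s = u ^ p *
  -- w`; the fraction need not be reduced.
  obtain ⟨l, hlZ, hmin⟩ := Z.exists_min_image (fun k => (o k : ℚ) / ((μ - k : ℕ) : ℚ)) hZne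
  obtain ⟨hlμ, hl⟩ : l < μ ∧ ¬ ∀ᶠ τ in 𝓝 0, (H τ).coeff l = 0 := by simpa [hZ] using hlZ
  have hcross : ∀ k ∈ Z, o l * (μ - k) ≤ o k * (μ - l) := by
    intro k hk
    have hkμ : k < μ := by simpa using (Finset.mem_filter.1 hk).1
    have := hmin k hk
    rw [div_le_div_iff₀ (by exact_mod_cast Nat.sub_pos_of_lt hlμ)
      (by exact_mod_cast Nat.sub_pos_of_lt hkμ)] at this
    exact_mod_cast this
  have hp : 0 < o l := by
    rw [Nat.pos_iff_ne_zero]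
    intro h0
    have := (hfac l).self_of_nhds
    rw [h0, pow_zero, one_mul, hlow l hlμ] at this
    exact hnz l hlμ hl this.symm
  set p := o l with hpdef
  set q := μ - l with hqdef
  have hq : 0 < q := Nat.sub_pos_of_lt hlμ
  have hexp : ∀ k, k ∈ Z ∨ μ ≤ k → p * μ ≤ q * o k + p * k := by
    rintro k (hk | hk)
    · have hkμ : k < μ := by simpa using (Finset.mem_filter.1 hk).1
      have h1 := hcross k hk
      have h2 : p * μ = p * (μ - k) + p * k := by rw [← mul_add]; congr 1; omega
      rw [h2, mul_comm q]
      omega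
    · exact (Nat.mul_le_mul_left p hk).trans (Nat.le_add_left _ _)
  -- The truncated subtraction is exact for `k ∈ Z` and for `k ≥ μ` by `hexp`; for the remaining `k`
  -- the factor `g k` is zero.
  set c : ℕ → ℂ → ℂ := fun k u => u ^ (q * o k + p * k - p * μ) * g k (u ^ q) with hc
  have hca : ∀ k, AnalyticAt ℂ (c k) 0 := by
    intro k
    have h1 : AnalyticAt ℂ (fun u : ℂ => g k (u ^ q)) 0 :=
      AnalyticAt.fun_comp (by simpa [hq.ne'] using hg k) (analyticAt_id.pow q)
    exact (analyticAt_id.pow _).mul h1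
  set K : ℂ → ℂ[X] := fun u => ∑ k ∈ Finset.range (d + 1), C (c k u) * X ^ k with hK
  have hKc : ∀ u k, (K u).coeff k = if k ≤ d then c k u else 0 := by
    intro u k
    simp only [hK, finsetSum_coeff, coeff_C_mul_X_pow]
    simp
  have hμd : μ ≤ d := (le_natDegree_of_ne_zero hμ).trans (hd 0)
  have hc0 : ∀ k, c k 0 = 0 ^ (q * o k + p * k - p * μ) * g k 0 := by
    intro k; simp [hc, hq.ne']
  refine ⟨p, q, K, hp, hq, ⟨⟨d, fun u => ?_⟩, fun k => ?_⟩, ?_, ?_, ?_, ?_, l, hlμ, ?_⟩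
  · exact natDegree_le_iff_coeff_eq_zero.2 fun k hk => by rw [hKc, if_neg (by omega)]
  · simp only [hKc]
    split_ifs
    · exact hca k
    · exact analyticAt_const
  · have hev : ∀ᶠ u in 𝓝 (0 : ℂ), ∀ k ∈ Finset.range (d + 1),
        u ^ (p * μ) * c k u = (H (u ^ q)).coeff k * u ^ (p * k) := by
      rw [Filter.eventually_all_finset]
      intro k _
      by_cases hkZ : k ∈ Z ∨ μ ≤ k
      · filter_upwards [(Tendsto.pow_nhds_zero hq).eventually (hfac k)] with u hu
        rw [hu, hc, ← mul_assoc, ← pow_add, Nat.add_sub_cancel' (hexp k hkZ), pow_add, pow_mul]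
        ring
      · push Not at hkZ
        have hz : ∀ᶠ τ in 𝓝 0, (H τ).coeff k = 0 := by
          by_contra h
          exact hkZ.1 (Finset.mem_filter.2 ⟨Finset.mem_range.2 hkZ.2, h⟩)
        filter_upwards [(Tendsto.pow_nhds_zero hq).eventually hz] with u hu
        simp [hu, hc, hzero k hkZ.2 hz]
    filter_upwards [hev] with u hu w
    rw [eval_eq d hd]
    simp only [hK, eval_finsetSum, eval_mul, eval_C, eval_pow, eval_X, Finset.mul_sum]
    refine Finset.sum_congr rfl fun k hk => ?_
    rw [← mul_assoc, hu k hk, mul_pow, ← pow_mul]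
    ring
  · intro j hj
    rw [hKc]
    split_ifs with h
    · rw [hc0, (hhigh j hj.le).1, zero_pow, zero_mul]
      have := Nat.mul_lt_mul_of_pos_left hj hp
      omega
    · rfl
  · rw [hKc, if_pos hμd, hc0, (hhigh μ le_rfl).1, (hhigh μ le_rfl).2]
    simpa using hμ
  · rw [hKc, if_pos (by omega), hc0, hzero (μ - 1) (by omega) hsub]
    simp
  · rw [hKc, if_pos (by omega), hc0]
    have : q * o l + p * l - p * μ = 0 := by
      have : q * o l + p * l = p * μ := by
        rw [mul_comm q, ← mul_add]
        congr 1; omega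
      omega
    rw [this]
    simpa using hnz l hlμ hl

/-- Newton–Puiseux: a root at `τ = 0` of a family of polynomials with analytic coefficients extends
to a root which is analytic in some `N`-th root of `τ`. -/
theorem exists_puiseux_root {μ : ℕ} (hμ0 : 0 < μ) (hH : AnalyticPolyFamily H)
    (hlow : ∀ k < μ, (H 0).coeff k = 0) (hμ : (H 0).coeff μ ≠ 0) :
    ∃ (N : ℕ) (s : ℂ → ℂ), 0 < N ∧ AnalyticAt ℂ s 0 ∧ s 0 = 0 ∧
      ∀ᶠ u in 𝓝 0, (H (u ^ N)).eval (s u) = 0 := by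
  induction μ using Nat.strong_induction_on generalizing H with
  | _ μ ih =>
  obtain rfl | hμ1 : μ = 1 ∨ 1 < μ := by omega
  · obtain ⟨σ, hσ, hσ0, h⟩ := hH.exists_analytic_root (hlow 0 one_pos) hμ
    exact ⟨1, σ, one_pos, hσ, hσ0, by simpa using h⟩
  -- Tschirnhaus shift: the Hasse derivative of order `μ - 1` has a simple root at `0`, and
  -- translating by its analytic continuation `σ` kills the coefficient of degree `μ - 1`.
  obtain ⟨σ, hσ, hσ0, hσr⟩ := (hH.hasseDeriv (μ - 1)).exists_analytic_root
    (by simp [hasseDeriv_coeff, hlow (μ - 1) (by omega)]) (by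
      rw [hasseDeriv_coeff, show 1 + (μ - 1) = μ by omega]
      exact mul_ne_zero (by exact_mod_cast (Nat.choose_pos (Nat.sub_le _ _)).ne') hμ)
  have hT := hH.taylor hσ
  have hT0 : Polynomial.taylor (σ 0) (H 0) = H 0 := by rw [hσ0, taylor_zero]
  have hTeval : ∀ τ w, (Polynomial.taylor (σ τ) (H τ)).eval w = (H τ).eval (w + σ τ) :=
    fun τ w => taylor_eval _ _ _
  by_cases hall : ∀ k < μ, ∀ᶠ τ in 𝓝 0, (Polynomial.taylor (σ τ) (H τ)).coeff k = 0
  · refine ⟨1, σ, one_pos, hσ, hσ0, ?_⟩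
    filter_upwards [hall 0 hμ0] with τ h
    rw [coeff_zero_eq_eval_zero, hTeval, zero_add] at h
    simpa only [pow_one] using h
  simp only [not_forall, exists_prop] at hall
  obtain ⟨p, q, K, hp, hq, hK, hKH, hK1, hK2, hK3, k, hk, hKk⟩ :=
    hT.exists_rescaling (μ := μ) (by simpa only [hT0] using hlow) (by simpa only [hT0] using hμ)
      (by simpa only [taylor_coeff] using hσr) hall
  -- The rescaled limit has a root of multiplicity below `μ`, so the induction continues from there.
  obtain ⟨w, hw0, hwμ⟩ := exists_rootMultiplicity_lt hK1 hK2 hK3 hk hKk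
  have hmult : (K 0).rootMultiplicity w = (Polynomial.taylor w (K 0)).natTrailingDegree :=
    rootMultiplicity_eq_natTrailingDegree
  have hT0ne : Polynomial.taylor w (K 0) ≠ 0 := by
    intro h
    rw [taylor_eq_zero] at h
    exact hK2 (by simp [h])
  obtain ⟨N, s, hN, hs, hs0, hroot⟩ := ih _ hwμ hw0 (hK.taylor (σ := fun _ => w) analyticAt_const)
    (fun j hj => coeff_eq_zero_of_lt_natTrailingDegree (hmult ▸ hj))
    (by rw [hmult]; exact mt trailingCoeff_eq_zero.1 hT0ne)
  refine ⟨N * q, fun u => σ (u ^ (N * q)) + u ^ (N * p) * (s u + w), Nat.mul_pos hN hq, ?_, ?_, ?_⟩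
  · have h1 : AnalyticAt ℂ (fun u : ℂ => σ (u ^ (N * q))) 0 :=
      AnalyticAt.fun_comp (by simpa [hN.ne', hq.ne'] using hσ) (analyticAt_id.pow (N * q))
    exact h1.add ((analyticAt_id.pow _).mul (hs.add analyticAt_const))
  · simp [hN.ne', hp.ne', hq.ne', hσ0]
  · filter_upwards [hroot, (Tendsto.pow_nhds_zero hN).eventually hKH] with u h1 h2
    have h3 := h2 (s u + w)
    rw [taylor_eval] at h1
    rw [h1, mul_zero, hTeval, ← pow_mul, ← pow_mul] at h3
    rw [add_comm (σ _)]
    exact h3.symm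

end AnalyticPolyFamily

/-! ### Degrees and growth at infinity. -/

theorem eventually_nhdsNE_zero_iff_cobounded {p : ℂ → Prop} :
    (∀ᶠ s in 𝓝[≠] (0 : ℂ), p s⁻¹) ↔ ∀ᶠ t in cobounded ℂ, p t := by
  rw [← Filter.inv_nhdsNE_zero, ← Filter.map_inv, Filter.eventually_map]

theorem eventually_cobounded_iff_exists_norm {p : ℂ → Prop} :
    (∀ᶠ t in cobounded ℂ, p t) ↔ ∃ R : ℝ, ∀ t, R < ‖t‖ → p t := by
  rw [← comap_norm_atTop, (atTop_basis_Ioi.comap _).eventually_iff]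
  simp

/-- Allows identities valid near infinity to be differentiated. -/
theorem eventually_cobounded_eventually_nhds {p : ℂ → Prop} (h : ∀ᶠ t in cobounded ℂ, p t) :
    ∀ᶠ t in cobounded ℂ, ∀ᶠ s in 𝓝 t, p s := by
  obtain ⟨R, hR⟩ := eventually_cobounded_iff_exists_norm.1 h
  refine eventually_cobounded_iff_exists_norm.2 ⟨R, fun t ht => ?_⟩
  filter_upwards [(isOpen_lt continuous_const continuous_norm).mem_nhds ht] with s hs
  exact hR s hs

theorem eventually_cobounded_ne_zero : ∀ᶠ t in cobounded ℂ, t ≠ 0 :=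
  eventually_cobounded_iff_exists_norm.2 ⟨0, fun _ ht => norm_pos_iff.1 ht⟩

/-- Converts growth estimates back into inequalities between integer degrees. -/
theorem zpow_isBigO_zpow_cobounded {a b : ℤ} :
    ((fun t : ℂ => t ^ a) =O[cobounded ℂ] fun t => t ^ b) ↔ a ≤ b := by
  constructor
  · intro h
    by_contra! hab
    have h1 : (fun t : ℂ => t ^ (a - b)) =O[cobounded ℂ] fun _ => (1 : ℂ) := by
      refine (h.mul (isBigO_refl (fun t : ℂ => t ^ (-b)) _)).congr' ?_ ?_ <;>
      filter_upwards [eventually_cobounded_ne_zero] with t ht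
      · rw [← zpow_add₀ ht, sub_eq_add_neg]
      · rw [← zpow_add₀ ht, add_neg_cancel, zpow_zero]
    have h2 : Tendsto (fun t : ℂ => ‖t ^ (a - b)‖) (cobounded ℂ) atTop := by
      lift a - b to ℕ using by omega with m hm
      have hm0 : m ≠ 0 := by omega
      simp only [zpow_natCast, norm_pow]
      exact (tendsto_pow_atTop hm0).comp tendsto_norm_cobounded_atTop
    exact not_isBoundedUnder_of_tendsto_atTop h2 ((isBigO_one_iff ℂ).1 h1)
  · intro h
    refine IsBigO.of_bound 1 ?_
    filter_upwards [eventually_cobounded_le_norm (E := ℂ) 1] with t ht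
    rw [norm_zpow, norm_zpow, one_mul]
    exact zpow_le_zpow_right₀ ht h

/-- `φ` has degree exactly `e` at infinity: `φ t = t ^ e * g t⁻¹` with `g` analytic and nonzero
at `0`. -/
def HasDegInfty (φ : ℂ → ℂ) (e : ℤ) : Prop :=
  ∃ g : ℂ → ℂ, AnalyticAt ℂ g 0 ∧ g 0 ≠ 0 ∧ ∀ᶠ t in cobounded ℂ, φ t = t ^ e * g t⁻¹

theorem degInfty_eq_bot_iff {φ : ℂ → ℂ} : degInfty φ = ⊥ ↔ ∀ᶠ t in cobounded ℂ, φ t = 0 := by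
  rw [← eventually_nhdsNE_zero_iff_cobounded, ← meromorphicOrderAt_eq_top_iff]
  unfold degInfty
  split
  · rename_i h
    exact iff_of_true rfl h
  · rename_i m h
    simp only [h, EReal.coe_ne_bot, false_iff]
    exact WithTop.coe_ne_top

theorem HasDegInfty.isTheta {φ : ℂ → ℂ} {e : ℤ} (h : HasDegInfty φ e) :
    φ =Θ[cobounded ℂ] fun t => t ^ e := by
  obtain ⟨g, hg, hg0, he⟩ := h
  have h1 : (fun t : ℂ => g t⁻¹) =Θ[cobounded ℂ] fun _ => (1 : ℂ) :=
    have hlim := hg.continuousAt.tendsto.comp tendsto_inv₀_cobounded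
    ⟨hlim.isBigO_one ℂ, (isBigO_const_left_iff_pos_le_norm one_ne_zero).2
      ⟨‖g 0‖ / 2, half_pos (norm_pos_iff.2 hg0),
        hlim.norm.eventually (le_mem_nhds (half_lt_self (norm_pos_iff.2 hg0)))⟩⟩
  have h2 := (isTheta_refl (fun t : ℂ => t ^ e) (cobounded ℂ)).mul h1
  simp only [mul_one] at h2
  exact (EventuallyEq.isTheta he).trans h2

theorem HasDegInfty.meromorphicAtInfty {φ : ℂ → ℂ} {e : ℤ} (h : HasDegInfty φ e) :
    MeromorphicAtInfty φ := by
  obtain ⟨g, hg, hg0, he⟩ := h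
  have h1 : MeromorphicAt (fun s : ℂ => s ^ (-e) * g s) 0 :=
    ((MeromorphicAt.id 0).zpow (-e)).mul hg.meromorphicAt
  refine h1.congr ?_
  rw [← eventually_nhdsNE_zero_iff_cobounded] at he
  filter_upwards [he] with s hs
  rw [hs, inv_inv, zpow_neg, inv_zpow]

theorem HasDegInfty.degInfty_eq {φ : ℂ → ℂ} {e : ℤ} (h : HasDegInfty φ e) :
    degInfty φ = ((e : ℝ) : EReal) := by
  have hm : MeromorphicAt (fun s : ℂ => φ s⁻¹) 0 := h.meromorphicAtInfty
  obtain ⟨g, hg, hg0, he⟩ := h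
  have : meromorphicOrderAt (fun s : ℂ => φ s⁻¹) 0 = ((-e : ℤ) : WithTop ℤ) := by
    rw [meromorphicOrderAt_eq_int_iff hm]
    refine ⟨g, hg, hg0, ?_⟩
    rw [← eventually_nhdsNE_zero_iff_cobounded] at he
    filter_upwards [he] with s hs
    rw [hs, inv_inv, sub_zero, zpow_neg, inv_zpow, smul_eq_mul]
  unfold degInfty
  rw [this]
  simp

theorem MeromorphicAtInfty.eventually_zero_or_hasDegInfty {φ : ℂ → ℂ} (h : MeromorphicAtInfty φ) :
    (∀ᶠ t in cobounded ℂ, φ t = 0) ∨ ∃ e, HasDegInfty φ e := by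
  rcases ho : meromorphicOrderAt (fun s : ℂ => φ s⁻¹) 0 with _ | m
  · left
    rw [← eventually_nhdsNE_zero_iff_cobounded]
    exact meromorphicOrderAt_eq_top_iff.1 ho
  · right
    obtain ⟨g, hg, hg0, he⟩ := (meromorphicOrderAt_eq_int_iff h).1 ho
    refine ⟨-m, g, hg, hg0, ?_⟩
    rw [← eventually_nhdsNE_zero_iff_cobounded]
    filter_upwards [he] with s hs
    rw [hs, sub_zero, zpow_neg, inv_zpow, inv_inv, inv_inv, smul_eq_mul]

/-- Treats the zero germ, of degree `-∞`, on the same footing as the others. -/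
theorem MeromorphicAtInfty.degInfty_le_iff {φ : ℂ → ℂ} (h : MeromorphicAtInfty φ) {e : ℤ} :
    degInfty φ ≤ ((e : ℝ) : EReal) ↔ φ =O[cobounded ℂ] fun t => t ^ e := by
  rcases h.eventually_zero_or_hasDegInfty with h0 | ⟨a, ha⟩
  · simp only [degInfty_eq_bot_iff.2 h0, bot_le, true_iff]
    exact (EventuallyEq.trans_isBigO (f₂ := fun _ => (0 : ℂ)) h0 (isBigO_zero _ _))
  · rw [ha.degInfty_eq, ha.isTheta.isBigO_congr_left, zpow_isBigO_zpow_cobounded]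
    norm_cast

theorem HasDegInfty.unique {φ : ℂ → ℂ} {a b : ℤ} (ha : HasDegInfty φ a) (hb : HasDegInfty φ b) :
    a = b := by
  have := ha.degInfty_eq.symm.trans hb.degInfty_eq
  exact_mod_cast this

theorem HasDegInfty.comp_pow {φ : ℂ → ℂ} {e : ℤ} (h : HasDegInfty φ e) {N : ℕ} (hN : 0 < N) :
    HasDegInfty (fun t => φ (t ^ N)) (N * e) := by
  obtain ⟨g, hg, hg0, he⟩ := h
  refine ⟨fun s => g (s ^ N), AnalyticAt.fun_comp (by simpa [hN.ne'] using hg)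
    (analyticAt_id.pow N), by simpa [hN.ne'] using hg0, ?_⟩
  filter_upwards [(tendsto_pow_cobounded_cobounded (α := ℂ) hN.ne').eventually he] with t ht
  rw [ht, inv_pow, zpow_mul, zpow_natCast]

/-- The derivative of a function of degree `e` at infinity. -/
theorem HasDegInfty.hasDerivAt {φ : ℂ → ℂ} {e : ℤ} (h : HasDegInfty φ e) :
    ∃ k : ℂ → ℂ, AnalyticAt ℂ k 0 ∧ (e ≠ 0 → k 0 ≠ 0) ∧
      ∀ᶠ t in cobounded ℂ, HasDerivAt φ (t ^ (e - 1) * k t⁻¹) t := by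
  obtain ⟨g, hg, hg0, he⟩ := h
  -- With `s = t⁻¹`, the derivative of `t ^ e * g t⁻¹` is `t ^ (e - 1) * (e * g s - s * g' s)`,
  -- whose second factor is `e * g 0` at `s = 0`.
  refine ⟨fun s => e * g s - s * deriv g s, (analyticAt_const.mul hg).sub (analyticAt_id.mul hg.deriv),
    fun he0 => by simp [he0, hg0], ?_⟩
  filter_upwards [eventually_cobounded_eventually_nhds he, eventually_cobounded_ne_zero,
    tendsto_inv₀_cobounded.eventually hg.eventually_analyticAt] with t h1 h2 h3
  have h4 : HasDerivAt (fun t : ℂ => g t⁻¹) (deriv g t⁻¹ * -(t ^ 2)⁻¹) t :=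
    h3.differentiableAt.hasDerivAt.comp t (hasDerivAt_inv h2)
  have h5 := (hasDerivAt_zpow e t (Or.inl h2)).mul h4
  refine (h5.congr_of_eventuallyEq h1).congr_deriv ?_
  rw [zpow_sub_one₀ h2]
  field_simp
  ring

theorem HasDegInfty.deriv_of_ne_zero {φ : ℂ → ℂ} {e : ℤ} (h : HasDegInfty φ e) (he : e ≠ 0) :
    HasDegInfty (deriv φ) (e - 1) := by
  obtain ⟨k, hk, hk0, hd⟩ := h.hasDerivAt
  exact ⟨k, hk, hk0 he, hd.mono fun t ht => ht.deriv⟩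

theorem MeromorphicAtInfty.eventually_differentiableAt {φ : ℂ → ℂ} (h : MeromorphicAtInfty φ) :
    ∀ᶠ t in cobounded ℂ, DifferentiableAt ℂ φ t := by
  rcases h.eventually_zero_or_hasDegInfty with h0 | ⟨a, ha⟩
  · filter_upwards [eventually_cobounded_eventually_nhds h0] with t ht
    exact (differentiableAt_const (0 : ℂ)).congr_of_eventuallyEq ht
  · obtain ⟨k, -, -, hd⟩ := ha.hasDerivAt
    exact hd.mono fun t ht => ht.differentiableAt

theorem MeromorphicAtInfty.deriv_isBigO {φ : ℂ → ℂ} (h : MeromorphicAtInfty φ) {e : ℤ}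
    (he : φ =O[cobounded ℂ] fun t => t ^ e) :
    deriv φ =O[cobounded ℂ] fun t => t ^ (e - 1) := by
  rcases h.eventually_zero_or_hasDegInfty with h0 | ⟨a, ha⟩
  · have : deriv φ =ᶠ[cobounded ℂ] fun _ => 0 := by
      filter_upwards [eventually_cobounded_eventually_nhds h0] with t ht
      rw [EventuallyEq.deriv_eq (f := fun _ => (0 : ℂ)) ht]
      simp
    exact this.trans_isBigO (isBigO_zero _ _)
  · have hae : a ≤ e := zpow_isBigO_zpow_cobounded.1 (ha.isTheta.symm.isBigO.trans he)
    obtain ⟨k, hk, -, hd⟩ := ha.hasDerivAt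
    have h1 : (fun t : ℂ => k t⁻¹) =O[cobounded ℂ] fun _ => (1 : ℂ) :=
      (hk.continuousAt.tendsto.comp tendsto_inv₀_cobounded).isBigO_one ℂ
    have h2 := (isBigO_refl (fun t : ℂ => t ^ (a - 1)) (cobounded ℂ)).mul h1
    simp only [mul_one] at h2
    exact (EventuallyEq.trans_isBigO (hd.mono fun t ht => ht.deriv) h2).trans
      (zpow_isBigO_zpow_cobounded.2 (by omega))

namespace MeromorphicAtInfty

theorem const (c : ℂ) : MeromorphicAtInfty fun _ => c := MeromorphicAt.const c 0

theorem add {φ ψ : ℂ → ℂ} (hφ : MeromorphicAtInfty φ) (hψ : MeromorphicAtInfty ψ) :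
    MeromorphicAtInfty fun t => φ t + ψ t := MeromorphicAt.fun_add hφ hψ

theorem sub {φ ψ : ℂ → ℂ} (hφ : MeromorphicAtInfty φ) (hψ : MeromorphicAtInfty ψ) :
    MeromorphicAtInfty fun t => φ t - ψ t := MeromorphicAt.fun_sub hφ hψ

theorem mul {φ ψ : ℂ → ℂ} (hφ : MeromorphicAtInfty φ) (hψ : MeromorphicAtInfty ψ) :
    MeromorphicAtInfty fun t => φ t * ψ t := MeromorphicAt.fun_mul hφ hψ

theorem zpow (m : ℤ) : MeromorphicAtInfty fun t => t ^ m :=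
  HasDegInfty.meromorphicAtInfty (e := m) ⟨fun _ => 1, analyticAt_const, one_ne_zero, by simp⟩

theorem of_analyticAt {g : ℂ → ℂ} (hg : AnalyticAt ℂ g 0) :
    MeromorphicAtInfty fun t => g t⁻¹ := by
  simpa [MeromorphicAtInfty] using hg.meromorphicAt

theorem comp_pow {φ : ℂ → ℂ} (h : MeromorphicAtInfty φ) {N : ℕ} (hN : 0 < N) :
    MeromorphicAtInfty fun t => φ (t ^ N) := by
  rcases h.eventually_zero_or_hasDegInfty with h0 | ⟨a, ha⟩
  · refine (MeromorphicAt.const (0 : ℂ) 0).congr ?_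
    have := (tendsto_pow_cobounded_cobounded (α := ℂ) hN.ne').eventually h0
    rw [← eventually_nhdsNE_zero_iff_cobounded] at this
    exact this.mono fun s hs => hs.symm
  · exact (ha.comp_pow hN).meromorphicAtInfty

theorem mvPolynomial_eval {k : ℕ} (f : MvPolynomial (Fin k) ℂ) {Φ : ℂ → Fin k → ℂ}
    (h : ∀ i, MeromorphicAtInfty fun t => Φ t i) :
    MeromorphicAtInfty fun t => MvPolynomial.eval (Φ t) f := by
  induction f using MvPolynomial.induction_on with
  | C a => simpa using const a
  | add p q hp hq => simpa using hp.add hq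
  | mul_X p i hp => simpa using hp.mul (h i)

end MeromorphicAtInfty

/-! ### The chain rule and the growth of a monic form. -/

/-- The chain rule for a polynomial along a differentiable curve. -/
theorem MvPolynomial.hasDerivAt_eval_comp {k : ℕ} (f : MvPolynomial (Fin k) ℂ) {Φ : ℂ → Fin k → ℂ}
    {Φ' : Fin k → ℂ} {t : ℂ} (h : ∀ i, HasDerivAt (fun t => Φ t i) (Φ' i) t) :
    HasDerivAt (fun t => MvPolynomial.eval (Φ t) f)
      (∑ i, MvPolynomial.eval (Φ t) (MvPolynomial.pderiv i f) * Φ' i) t := by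
  induction f using MvPolynomial.induction_on with
  | C a => simpa using hasDerivAt_const t a
  | add p q hp hq =>
    simpa [add_mul, Finset.sum_add_distrib] using hp.fun_add hq
  | mul_X p j hp =>
    simp only [map_mul, MvPolynomial.eval_X]
    refine (hp.fun_mul (h j)).congr_deriv ?_
    simp only [Derivation.leibniz, smul_eq_mul, map_add, map_mul, MvPolynomial.eval_X, add_mul,
      Finset.sum_add_distrib, MvPolynomial.pderiv_X]
    rw [add_comm, Finset.sum_mul]
    congr 1
    · rw [Finset.sum_eq_single j] <;> simp +contextual [eq_comm]
    · exact Finset.sum_congr rfl fun i _ => by ring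

theorem Polynomial.exists_norm_eval_le {p : ℂ[X]} {i : ℕ} (hp : p.natDegree ≤ i) :
    ∃ K : ℝ, 0 ≤ K ∧ ∀ x, ‖p.eval x‖ ≤ K * (1 + ‖x‖) ^ i := by
  refine ⟨∑ k ∈ Finset.range (i + 1), ‖p.coeff k‖, by positivity, fun x => ?_⟩
  rw [eval_eq_sum_range' (Nat.lt_succ_of_le hp), Finset.sum_mul]
  refine (norm_sum_le _ _).trans (Finset.sum_le_sum fun k hk => ?_)
  rw [norm_mul, norm_pow]
  refine mul_le_mul_of_nonneg_left ?_ (norm_nonneg _)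
  have hx := norm_nonneg x
  calc ‖x‖ ^ k ≤ (1 + ‖x‖) ^ k := by gcongr; linarith
    _ ≤ (1 + ‖x‖) ^ i :=
      pow_le_pow_right₀ (by linarith) (Nat.lt_succ_iff.1 (Finset.mem_range.1 hk))

theorem MvPolynomial.eval_aeval_X_zero (p : ℂ[X]) (x y : ℂ) :
    MvPolynomial.eval ![x, y] (Polynomial.aeval (MvPolynomial.X 0 : MvPolynomial (Fin 2) ℂ) p) =
      p.eval x := by
  induction p using Polynomial.induction_on' with
  | add p q hp hq => simp [hp, hq]
  | monomial k a => simp [Polynomial.aeval_monomial, MvPolynomial.algebraMap_eq]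

/-- A polynomial monic in `y` with `deg aᵢ ≤ i` is comparable with `yⁿ` away from a cone around
the `x`-axis. -/
theorem IsMonicForm.exists_norm_pow_le {f : MvPolynomial (Fin 2) ℂ} {n : ℕ} (hf : IsMonicForm f n)
    (hn : 0 < n) (lam : ℂ) :
    ∃ C : ℝ, 1 ≤ C ∧ ∀ x y : ℂ, C * (1 + ‖x‖) ≤ ‖y‖ →
      ‖y‖ ^ n / 2 ≤ ‖MvPolynomial.eval ![x, y] f - lam‖ := by
  obtain ⟨a, ha, rfl⟩ := hf
  have hK : ∀ i, ∃ K : ℝ, 0 ≤ K ∧ (i ∈ Finset.Icc 1 n →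
      ∀ x, ‖(a i).eval x‖ ≤ K * (1 + ‖x‖) ^ i) := by
    intro i
    by_cases hi : i ∈ Finset.Icc 1 n
    · obtain ⟨K, h0, h⟩ := exists_norm_eval_le (ha i hi)
      exact ⟨K, h0, fun _ => h⟩
    · exact ⟨0, le_rfl, fun h => (hi h).elim⟩
  choose K hK0 hK using hK
  set L := ∑ i ∈ Finset.Icc 1 n, K i + ‖lam‖ with hL
  have hL0 : 0 ≤ L := add_nonneg (Finset.sum_nonneg fun i _ => hK0 i) (norm_nonneg _)
  -- When `C (1 + |x|) ≤ |y|`, each lower term is at most `K i |y| ^ n / C`, so all of them together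
  -- with `lam` are at most `(L / C) |y| ^ n`; hence the choice `C > 2 L`.
  refine ⟨2 * L + 1, by linarith, fun x y hxy => ?_⟩
  set C := 2 * L + 1 with hC
  have hC1 : 1 ≤ C := by linarith
  have hx := norm_nonneg x
  have hy1 : 1 ≤ ‖y‖ := le_trans (by nlinarith) hxy
  have hyC : C ≤ ‖y‖ := le_trans (by nlinarith) hxy
  have hterm : ∀ i ∈ Finset.Icc 1 n, C * ‖(a i).eval x * y ^ (n - i)‖ ≤ K i * ‖y‖ ^ n := by
    intro i hi
    have hi' := Finset.mem_Icc.1 hi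
    rw [norm_mul, norm_pow]
    calc C * (‖(a i).eval x‖ * ‖y‖ ^ (n - i))
        ≤ C * (K i * (1 + ‖x‖) ^ i * ‖y‖ ^ (n - i)) := by gcongr; exact hK i hi x
      _ ≤ C ^ i * (K i * (1 + ‖x‖) ^ i * ‖y‖ ^ (n - i)) := by
          have := hK0 i
          gcongr
          exact le_self_pow₀ hC1 (by omega)
      _ = K i * ((C * (1 + ‖x‖)) ^ i * ‖y‖ ^ (n - i)) := by rw [mul_pow]; ring
      _ ≤ K i * (‖y‖ ^ i * ‖y‖ ^ (n - i)) := by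
          have := hK0 i
          gcongr
      _ = K i * ‖y‖ ^ n := by rw [← pow_add, Nat.add_sub_cancel' hi'.2]
  have hlam : C * ‖lam‖ ≤ ‖lam‖ * ‖y‖ ^ n := by
    rw [mul_comm]
    gcongr
    exact hyC.trans (le_self_pow₀ hy1 hn.ne')
  set s := ∑ i ∈ Finset.Icc 1 n, (a i).eval x * y ^ (n - i) with hs
  have hsum : C * (‖s‖ + ‖lam‖) ≤ L * ‖y‖ ^ n := by
    have h1 : C * ‖s‖ ≤ ∑ i ∈ Finset.Icc 1 n, K i * ‖y‖ ^ n :=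
      (mul_le_mul_of_nonneg_left (norm_sum_le _ _) (by linarith)).trans
        (by rw [Finset.mul_sum]; exact Finset.sum_le_sum hterm)
    rw [← Finset.sum_mul] at h1
    calc C * (‖s‖ + ‖lam‖) = C * ‖s‖ + C * ‖lam‖ := mul_add _ _ _
      _ ≤ _ := add_le_add h1 hlam
      _ = L * ‖y‖ ^ n := (add_mul _ _ _).symm
  have hyn : 0 < ‖y‖ ^ n := by positivity
  have hsmall : ‖s‖ + ‖lam‖ ≤ ‖y‖ ^ n / 2 := by
    by_contra! h
    nlinarith
  have heval : MvPolynomial.eval ![x, y] (MvPolynomial.X 1 ^ n + ∑ i ∈ Finset.Icc 1 n,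
      Polynomial.aeval (MvPolynomial.X 0 : MvPolynomial (Fin 2) ℂ) (a i) *
        MvPolynomial.X 1 ^ (n - i)) = y ^ n + s := by
    simp [hs, MvPolynomial.eval_aeval_X_zero]
  rw [heval]
  have h1 : ‖y ^ n‖ ≤ ‖y ^ n + s - lam‖ + (‖s‖ + ‖lam‖) := by
    calc ‖y ^ n‖ = ‖(y ^ n + s - lam) - (s - lam)‖ := by congr 1; ring
      _ ≤ ‖y ^ n + s - lam‖ + ‖s - lam‖ := norm_sub_le _ _
      _ ≤ _ := by gcongr; exact norm_sub_le _ _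
  rw [norm_pow] at h1
  linarith

/-! ### Bounds in terms of the nearest root. -/

/-- Lower bounds for a product of linear factors, or for its derivative, in terms of the distances
of the root nearest to `y` to the other roots. -/
theorem norm_prod_or_norm_deriv_ge_of_nearest {n : ℕ} (b : Fin n → ℂ) (y : ℂ) (i : Fin n)
    (hi : ∀ j, ‖y - b i‖ ≤ ‖y - b j‖) {δ : ℝ} (hδ0 : 0 < δ)
    (hδ : ∀ j, j ≠ i → δ ≤ ‖b i - b j‖) :
    δ / (4 * n) * ∏ j ∈ Finset.univ.erase i, (‖b i - b j‖ / 2) ≤ ‖∏ j, (y - b j)‖ ∨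
    1 / 2 * ∏ j ∈ Finset.univ.erase i, (‖b i - b j‖ / 2) ≤
      ‖∑ k, ∏ j ∈ Finset.univ.erase k, (y - b j)‖ := by
  have hn : 0 < n := i.pos
  have hn' : (0 : ℝ) < n := by exact_mod_cast hn
  have hhalf : ∀ j, ‖b i - b j‖ / 2 ≤ ‖y - b j‖ := by
    intro j
    have h1 : ‖b i - b j‖ ≤ ‖y - b j‖ + ‖y - b i‖ := by
      calc ‖b i - b j‖ = ‖(y - b j) - (y - b i)‖ := by congr 1; ring
        _ ≤ _ := norm_sub_le _ _
    linarith [hi j]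
  set Q := ∏ j ∈ Finset.univ.erase i, (‖b i - b j‖ / 2) with hQ
  set P := ‖∏ j ∈ Finset.univ.erase i, (y - b j)‖ with hP
  have hQP : Q ≤ P := by
    rw [hP, norm_prod]
    exact Finset.prod_le_prod (fun j _ => by positivity) fun j _ => hhalf j
  have hQ0 : 0 ≤ Q := Finset.prod_nonneg fun j _ => by positivity
  have htot : ∀ k, ‖∏ j ∈ Finset.univ.erase k, (y - b j)‖ * ‖y - b k‖ = ‖∏ j, (y - b j)‖ := by
    intro k
    rw [← norm_mul, Finset.prod_erase_mul _ _ (Finset.mem_univ k)]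
  -- Below this threshold, the summand that omits `k ≠ i` is `P |y - b i| / |y - b k| ≤ P (δ / 4n) /
  -- (δ / 2) = P / (2n)`. These fewer than `n` summands cannot cancel more than half of the main
  -- one.
  rcases le_or_gt (δ / (4 * n)) ‖y - b i‖ with h | h
  · left
    rw [← htot i, mul_comm]
    exact mul_le_mul hQP h (by positivity) (norm_nonneg _)
  · right
    have hk : ∀ k ∈ Finset.univ.erase i, ‖∏ j ∈ Finset.univ.erase k, (y - b j)‖ ≤ P / (2 * n) := by
      intro k hk
      have h1 := (htot k).trans (htot i).symm
      have h2 : δ / 2 ≤ ‖y - b k‖ := le_trans (by linarith [hδ k (Finset.ne_of_mem_erase hk)]) (hhalf k)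
      have h3 : ‖∏ j ∈ Finset.univ.erase k, (y - b j)‖ * (δ / 2) ≤ P * (δ / (4 * n)) :=
        (mul_le_mul_of_nonneg_left h2 (norm_nonneg _)).trans
          (h1.le.trans (mul_le_mul_of_nonneg_left h.le (norm_nonneg _)))
      have h4 : P * (δ / (4 * n)) = P / (2 * n) * (δ / 2) := by field_simp; ring
      rw [h4] at h3
      exact le_of_mul_le_mul_right h3 (by linarith)
    have hrest : ‖∑ k ∈ Finset.univ.erase i, ∏ j ∈ Finset.univ.erase k, (y - b j)‖ ≤ P / 2 := by
      refine (norm_sum_le _ _).trans ((Finset.sum_le_card_nsmul _ _ _ hk).trans ?_)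
      rw [nsmul_eq_mul]
      have hcard : ((Finset.univ.erase i).card : ℝ) ≤ n := by
        exact_mod_cast (Finset.card_le_univ _).trans_eq (Fintype.card_fin n)
      calc ((Finset.univ.erase i).card : ℝ) * (P / (2 * n)) ≤ n * (P / (2 * n)) := by gcongr
        _ = P / 2 := by field_simp
    rw [← Finset.add_sum_erase _ _ (Finset.mem_univ i)]
    have h5 : P ≤ ‖∏ j ∈ Finset.univ.erase i, (y - b j) +
        ∑ k ∈ Finset.univ.erase i, ∏ j ∈ Finset.univ.erase k, (y - b j)‖ +
        ‖∑ k ∈ Finset.univ.erase i, ∏ j ∈ Finset.univ.erase k, (y - b j)‖ := by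
      refine le_trans (le_of_eq ?_) (norm_sub_le _ _)
      rw [add_sub_cancel_right]
    linarith

/-- Finitely many pairs of roots allow one constant in all comparisons of `β i - β j` with a power
of `t`, so the nearest-root bound becomes uniform in `y`. -/
theorem exists_norm_prod_or_norm_deriv_ge {n : ℕ} {β : Fin n → ℂ → ℂ} {e : Fin n → Fin n → ℤ}
    {m : Fin n → ℤ} (he : ∀ i j, j ≠ i → HasDegInfty (fun t => β i t - β j t) (e i j))
    (hm : ∀ i j, j ≠ i → m i ≤ e i j) (hn : 0 < n) :
    ∃ c : ℝ, 0 < c ∧ ∀ᶠ t in cobounded ℂ, ∀ y : ℂ, ∃ i,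
      c * ‖t‖ ^ (∑ j ∈ Finset.univ.erase i, e i j + m i) ≤ ‖∏ j, (y - β j t)‖ ∨
      c * ‖t‖ ^ (∑ j ∈ Finset.univ.erase i, e i j) ≤
        ‖∑ k, ∏ j ∈ Finset.univ.erase k, (y - β j t)‖ := by
  have hn' : (0 : ℝ) < n := by exact_mod_cast hn
  have hlow : ∀ p : Fin n × Fin n, ∃ K : ℝ, 0 < K ∧ (p.2 ≠ p.1 → ∀ᶠ t in cobounded ℂ,
      ‖t‖ ^ (e p.1 p.2) ≤ K * ‖β p.1 t - β p.2 t‖) := by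
    rintro ⟨i, j⟩
    by_cases hij : j = i
    · exact ⟨1, one_pos, fun h => (h hij).elim⟩
    · obtain ⟨K, hK, h⟩ := (he i j hij).isTheta.2.exists_pos
      exact ⟨K, hK, fun _ => by simpa [norm_zpow] using h.bound⟩
  choose K hK0 hK using hlow
  obtain ⟨K', hK'⟩ := Finite.bddAbove_range K
  have hKK : ∀ p, K p ≤ K' := fun p => hK' ⟨p, rfl⟩
  have hK'0 : 0 < K' := (hK0 (⟨0, hn⟩, ⟨0, hn⟩)).trans_le (hKK _)
  set c₀ := K'⁻¹ with hc₀
  have hc₀0 : 0 < c₀ := inv_pos.2 hK'0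
  set A : ℝ := (c₀ / 2) ^ (n - 1) with hA
  have hA0 : 0 < A := by positivity
  refine ⟨min (c₀ / (4 * n) * A) (1 / 2 * A), by positivity, ?_⟩
  have hev : ∀ᶠ t in cobounded ℂ, ∀ p : Fin n × Fin n, p.2 ≠ p.1 →
      ‖t‖ ^ (e p.1 p.2) ≤ K p * ‖β p.1 t - β p.2 t‖ := by
    rw [eventually_all]
    intro p
    by_cases hp : p.2 = p.1
    · exact Eventually.of_forall fun t h => (h hp).elim
    · filter_upwards [hK p hp] with t ht _ using ht
  filter_upwards [hev, eventually_cobounded_le_norm (E := ℂ) 1] with t ht ht1 y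
  have : Nonempty (Fin n) := ⟨⟨0, hn⟩⟩
  obtain ⟨i, hi⟩ := Finite.exists_min fun j => ‖y - β j t‖
  have ht0 : 0 < ‖t‖ := by linarith
  have hdist : ∀ j, j ≠ i → c₀ * ‖t‖ ^ (e i j) ≤ ‖β i t - β j t‖ := by
    intro j hj
    rw [hc₀, inv_mul_le_iff₀ hK'0]
    exact (ht (i, j) hj).trans (mul_le_mul_of_nonneg_right (hKK _) (norm_nonneg _))
  have hprod : A * ‖t‖ ^ (∑ j ∈ Finset.univ.erase i, e i j) ≤
      ∏ j ∈ Finset.univ.erase i, (‖β i t - β j t‖ / 2) := by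
    have hcard : (Finset.univ.erase i).card = n - 1 := by
      rw [Finset.card_erase_of_mem (Finset.mem_univ i), Finset.card_univ, Fintype.card_fin]
    have hz : ‖t‖ ^ (∑ j ∈ Finset.univ.erase i, e i j) =
        ∏ j ∈ Finset.univ.erase i, ‖t‖ ^ (e i j) := by
      induction Finset.univ.erase i using Finset.induction_on with
      | empty => simp
      | insert a s ha ih => rw [Finset.sum_insert ha, Finset.prod_insert ha, zpow_add₀ ht0.ne', ih]
    rw [hA, ← hcard, ← Finset.prod_const, hz, ← Finset.prod_mul_distrib]
    refine Finset.prod_le_prod (fun j _ => by positivity) fun j hj => ?_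
    have := hdist j (Finset.ne_of_mem_erase hj)
    linarith
  refine ⟨i, ?_⟩
  rcases norm_prod_or_norm_deriv_ge_of_nearest (fun j => β j t) y i hi
    (δ := c₀ * ‖t‖ ^ (m i)) (by positivity) (fun j hj => le_trans
      (mul_le_mul_of_nonneg_left (zpow_le_zpow_right₀ ht1 (hm i j hj)) hc₀0.le) (hdist j hj))
    with h | h
  · left
    refine le_trans ?_ h
    rw [zpow_add₀ ht0.ne']
    calc min (c₀ / (4 * n) * A) (1 / 2 * A) *
          (‖t‖ ^ (∑ j ∈ Finset.univ.erase i, e i j) * ‖t‖ ^ (m i))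
        ≤ (c₀ / (4 * n) * A) * (‖t‖ ^ (∑ j ∈ Finset.univ.erase i, e i j) * ‖t‖ ^ (m i)) := by
          gcongr; exact min_le_left _ _
      _ = c₀ * ‖t‖ ^ (m i) / (4 * n) * (A * ‖t‖ ^ (∑ j ∈ Finset.univ.erase i, e i j)) := by ring
      _ ≤ _ := by gcongr
  · right
    refine le_trans ?_ h
    calc min (c₀ / (4 * n) * A) (1 / 2 * A) * ‖t‖ ^ (∑ j ∈ Finset.univ.erase i, e i j)
        ≤ (1 / 2 * A) * ‖t‖ ^ (∑ j ∈ Finset.univ.erase i, e i j) := by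
          gcongr; exact min_le_right _ _
      _ = 1 / 2 * (A * ‖t‖ ^ (∑ j ∈ Finset.univ.erase i, e i j)) := by ring
      _ ≤ _ := by gcongr

theorem eval_pderiv_one_eq_sum {f : MvPolynomial (Fin 2) ℂ} {lam x : ℂ} {n : ℕ} {b : Fin n → ℂ}
    (h : ∀ y, MvPolynomial.eval ![x, y] f - lam = ∏ i, (y - b i)) (y : ℂ) :
    MvPolynomial.eval ![x, y] (MvPolynomial.pderiv 1 f) =
      ∑ k, ∏ j ∈ Finset.univ.erase k, (y - b j) := by
  have h1 : HasDerivAt (fun y => MvPolynomial.eval ![x, y] f)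
      (∑ i, MvPolynomial.eval ![x, y] (MvPolynomial.pderiv i f) * ![0, 1] i) y := by
    refine MvPolynomial.hasDerivAt_eval_comp f fun i => ?_
    fin_cases i
    · exact hasDerivAt_const y x
    · exact hasDerivAt_id y
  have h2 : HasDerivAt (fun y => MvPolynomial.eval ![x, y] f - lam)
      (∑ k, (∏ j ∈ Finset.univ.erase k, (y - b j)) • (1 : ℂ)) y := by
    simp only [h]
    exact HasDerivAt.fun_finsetProd fun i _ => (hasDerivAt_id y).sub_const (b i)
  simpa using (h1.sub_const lam).unique h2

/-! ### Curves along which `f` tends to `lam`. -/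

theorem MeromorphicAtInfty.tendsto_zero {φ : ℂ → ℂ} (h : MeromorphicAtInfty φ)
    (hdeg : degInfty φ < 0) : Tendsto φ (cobounded ℂ) (𝓝 0) := by
  have h1 : φ =O[cobounded ℂ] fun t => t ^ (-1 : ℤ) := by
    rcases h.eventually_zero_or_hasDegInfty with h0 | ⟨e, he⟩
    · exact EventuallyEq.trans_isBigO (f₂ := fun _ => (0 : ℂ)) h0 (isBigO_zero _ _)
    · rw [he.degInfty_eq] at hdeg
      have : e < 0 := by exact_mod_cast hdeg
      exact he.isTheta.1.trans (zpow_isBigO_zpow_cobounded.2 (by omega))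
  refine h1.trans_tendsto ?_
  simpa using tendsto_inv₀_cobounded (α := ℂ)

/-- A root outside the cone `|y| ≤ C (1 + |x|)` would contradict the growth of `f - lam` there. This
is the source of `m i ≤ D`. -/
theorem IsMonicForm.roots_isBigO {f : MvPolynomial (Fin 2) ℂ} {n : ℕ} (hf : IsMonicForm f n)
    (hn : 0 < n) {lam : ℂ} {D : ℕ} {β : Fin n → ℂ → ℂ}
    (hroots : ∀ᶠ t in cobounded ℂ, ∀ y : ℂ,
      MvPolynomial.eval ![t ^ D, y] f - lam = ∏ i, (y - β i t)) (i : Fin n) :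
    β i =O[cobounded ℂ] fun t => t ^ (D : ℤ) := by
  obtain ⟨C, hC, h⟩ := hf.exists_norm_pow_le hn lam
  refine IsBigO.of_bound (2 * C) ?_
  filter_upwards [hroots, eventually_cobounded_le_norm (E := ℂ) 1] with t ht ht1
  have hpow : 1 ≤ ‖t ^ D‖ := by rw [norm_pow]; exact one_le_pow₀ ht1
  by_contra! hlt
  rw [zpow_natCast] at hlt
  have h1 := h (t ^ D) (β i t) (by nlinarith)
  rw [ht, Finset.prod_eq_zero (Finset.mem_univ i) (sub_self _), norm_zero] at h1
  have h2 : 0 < ‖β i t‖ ^ n := pow_pos (by nlinarith) n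
  linarith

theorem vecCons_apply_zero_apply_one (z : Fin 2 → ℂ) : ![z 0, z 1] = z := by
  ext i
  fin_cases i <;> rfl

/-- Along an unbounded curve on which `f - lam` has negative degree, the first component
dominates. -/
theorem IsMonicForm.hasDegInfty_of_isCurveToFiber {f : MvPolynomial (Fin 2) ℂ} {n : ℕ}
    (hf : IsMonicForm f n) (hn : 0 < n) {lam : ℂ} {Φ : ℂ → Fin 2 → ℂ}
    (hΦ : IsCurveToFiber f lam Φ) :
    ∃ d : ℤ, 0 < d ∧ HasDegInfty (fun t => Φ t 0) d ∧
      (fun t => Φ t 1) =O[cobounded ℂ] (fun t => t ^ d) ∧ degInftyMap Φ = ((d : ℝ) : EReal) := by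
  obtain ⟨hmer, hpos, hneg⟩ := hΦ
  obtain ⟨C, hC, h⟩ := hf.exists_norm_pow_le hn lam
  have hlim := (((MeromorphicAtInfty.mvPolynomial_eval f hmer).sub
    (MeromorphicAtInfty.const lam)).tendsto_zero hneg).norm
  rw [norm_zero] at hlim
  -- Since `f - lam` tends to `0`, the curve cannot stay outside the cone, where `|f - lam| ≥ 1 /
  -- 2`.
  have hsmall : ∀ᶠ t in cobounded ℂ, ‖Φ t 1‖ ≤ C * (1 + ‖Φ t 0‖) := by
    filter_upwards [hlim.eventually (gt_mem_nhds (show (0 : ℝ) < 1 / 2 by norm_num))] with t ht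
    by_contra! hlt
    have h1 := h _ _ hlt.le
    rw [vecCons_apply_zero_apply_one] at h1
    have h2 : 1 ≤ ‖Φ t 1‖ ^ n :=
      one_le_pow₀ (le_trans (by nlinarith [norm_nonneg (Φ t 0)]) hlt.le)
    linarith
  have hdom : ∀ d : ℤ, 0 ≤ d → (fun t => Φ t 0) =O[cobounded ℂ] (fun t => t ^ d) →
      (fun t => Φ t 1) =O[cobounded ℂ] (fun t => t ^ d) := by
    intro d hd h0
    have h1 : (fun t => (1 : ℂ) + ‖Φ t 0‖) =O[cobounded ℂ] (fun t => t ^ d) := by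
      refine IsBigO.add ?_ ?_
      · simpa using (zpow_isBigO_zpow_cobounded (a := 0)).2 hd
      · exact IsBigO.trans (IsBigO.of_bound 1 (by simp)) h0
    refine IsBigO.trans (IsBigO.of_bound C ?_) h1
    filter_upwards [hsmall] with t ht
    refine ht.trans_eq ?_
    rw [← Complex.ofReal_one, ← Complex.ofReal_add, Complex.norm_of_nonneg (by positivity)]
  have hmap : ∀ d : ℤ, 0 ≤ d → (fun t => Φ t 0) =O[cobounded ℂ] (fun t => t ^ d) →
      degInftyMap Φ ≤ ((d : ℝ) : EReal) := by
    intro d hd h0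
    refine Finset.sup_le fun i _ => (hmer i).degInfty_le_iff.2 ?_
    fin_cases i
    · exact h0
    · exact hdom d hd h0
  -- If the first component were bounded, so would be the second, against `deg Φ > 0`.
  have key : ∃ d : ℤ, 0 < d ∧ HasDegInfty (fun t => Φ t 0) d := by
    by_contra! hno
    refine (hpos.trans_le (hmap 0 le_rfl ?_)).ne (by simp)
    rcases (hmer 0).eventually_zero_or_hasDegInfty with h0 | ⟨e, he⟩
    · exact EventuallyEq.trans_isBigO (f₂ := fun _ => (0 : ℂ)) h0 (isBigO_zero _ _)
    · refine he.isTheta.1.trans (zpow_isBigO_zpow_cobounded.2 ?_)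
      by_contra! hlt
      exact hno e hlt he
  obtain ⟨d, hd, hΦ0⟩ := key
  refine ⟨d, hd, hΦ0, hdom d hd.le hΦ0.isTheta.1, le_antisymm (hmap d hd.le hΦ0.isTheta.1) ?_⟩
  rw [← hΦ0.degInfty_eq]
  exact Finset.le_sup (f := fun i => degInfty fun t => Φ t i) (Finset.mem_univ 0)

/-- The chain rule along a meromorphic curve. -/
theorem eventually_deriv_eval_sub_eq (f : MvPolynomial (Fin 2) ℂ) (lam : ℂ) {Φ : ℂ → Fin 2 → ℂ}
    (hmer : ∀ i, MeromorphicAtInfty fun t => Φ t i) :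
    ∀ᶠ t in cobounded ℂ, deriv (fun t => MvPolynomial.eval (Φ t) f - lam) t =
      polyGrad f (Φ t) 0 * deriv (fun t => Φ t 0) t +
        polyGrad f (Φ t) 1 * deriv (fun t => Φ t 1) t := by
  filter_upwards [(hmer 0).eventually_differentiableAt, (hmer 1).eventually_differentiableAt]
    with t h0 h1
  have h : HasDerivAt (fun t => MvPolynomial.eval (Φ t) f - lam) _ t :=
    (MvPolynomial.hasDerivAt_eval_comp f (Φ := Φ) (Φ' := fun i => deriv (fun t => Φ t i) t)
      fun i => by fin_cases i <;> [exact h0.hasDerivAt; exact h1.hasDerivAt]).sub_const lam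
  rw [h.deriv, Fin.sum_univ_two]
  rfl

/-! ### Lower bounds for the gradient. -/

section PointwiseBounds

variable {f : MvPolynomial (Fin 2) ℂ} {n : ℕ} {lam : ℂ} {D : ℕ} {β : Fin n → ℂ → ℂ}
  {e : Fin n → Fin n → ℤ} {m : Fin n → ℤ}

/-- Every `x` is a `D`-th power, so bounds in the parameter `t` reach all points with large `|x|`.
-/
theorem exists_norm_eval_or_norm_pderiv_ge (hn : 0 < n) (hD : 0 < D)
    (hroots : ∀ᶠ t in cobounded ℂ, ∀ y : ℂ,
      MvPolynomial.eval ![t ^ D, y] f - lam = ∏ i, (y - β i t))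
    (he : ∀ i j, j ≠ i → HasDegInfty (fun t => β i t - β j t) (e i j))
    (hm : ∀ i j, j ≠ i → m i ≤ e i j) :
    ∃ c R : ℝ, 0 < c ∧ 1 ≤ R ∧ ∀ x y : ℂ, R < ‖x‖ → ∃ t i, 1 ≤ ‖t‖ ∧ t ^ D = x ∧
      (c * ‖t‖ ^ (∑ j ∈ Finset.univ.erase i, e i j + m i) ≤
          ‖MvPolynomial.eval ![x, y] f - lam‖ ∨
        c * ‖t‖ ^ (∑ j ∈ Finset.univ.erase i, e i j) ≤
          ‖MvPolynomial.eval ![x, y] (MvPolynomial.pderiv 1 f)‖) := by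
  obtain ⟨c, hc, h⟩ := exists_norm_prod_or_norm_deriv_ge he hm hn
  obtain ⟨R, hR⟩ := eventually_cobounded_iff_exists_norm.1 (h.and hroots)
  have hR1 : (1 : ℝ) ≤ max R 1 := le_max_right _ _
  refine ⟨c, max R 1 ^ D, hc, one_le_pow₀ hR1, fun x y hx => ?_⟩
  obtain ⟨t, ht⟩ := IsAlgClosed.exists_pow_nat_eq x hD
  have htR : max R 1 < ‖t‖ := by
    rw [← ht, norm_pow] at hx
    exact lt_of_pow_lt_pow_left₀ D (norm_nonneg t) hx
  obtain ⟨h1, h2⟩ := hR t ((le_max_left _ _).trans_lt htR)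
  rw [ht] at h2
  obtain ⟨i, hi⟩ := h1 y
  refine ⟨t, i, hR1.trans htR.le, ht, ?_⟩
  rwa [h2, eval_pderiv_one_eq_sum h2]

/-- If no exponent is negative then `(f - lam, f_y)` stays away from zero near infinity. -/
theorem lojasiewiczExponent_nonneg (hf : IsMonicForm f n) (hn : 1 < n) (hD : 0 < D)
    (hroots : ∀ᶠ t in cobounded ℂ, ∀ y : ℂ,
      MvPolynomial.eval ![t ^ D, y] f - lam = ∏ i, (y - β i t))
    (he : ∀ i j, j ≠ i → HasDegInfty (fun t => β i t - β j t) (e i j))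
    (hm : ∀ i j, j ≠ i → m i ≤ e i j)
    (hnonneg : ∀ i, 0 ≤ ∑ j ∈ Finset.univ.erase i, e i j + m i) :
    0 ≤ lojasiewiczExponent
      (fun z => ![MvPolynomial.eval z f - lam, MvPolynomial.eval z (MvPolynomial.pderiv 1 f)])
      Set.univ := by
  obtain ⟨c, R, hc, hR, h⟩ := exists_norm_eval_or_norm_pderiv_ge (by omega) hD hroots he hm
  obtain ⟨C, hC, hgrow⟩ := hf.exists_norm_pow_le (by omega) lam
  -- Either `m i ≥ 0` and every summand is nonnegative, or removing the negative `m i` only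
  -- increases the total.
  have hS : ∀ i, 0 ≤ ∑ j ∈ Finset.univ.erase i, e i j := by
    intro i
    rcases le_or_gt 0 (m i) with h0 | h0
    · exact Finset.sum_nonneg fun j hj => h0.trans (hm i j (Finset.ne_of_mem_erase hj))
    · linarith [hnonneg i]
  have hmem : (0 : ℝ) ∈ lojasiewiczSet
      (fun z => ![MvPolynomial.eval z f - lam, MvPolynomial.eval z (MvPolynomial.pderiv 1 f)])
      Set.univ := by
    -- Beyond this radius, a point with `|x| ≤ R` has `y` as its large coordinate and lies outside
    -- the cone, so `f - lam` alone is bounded below.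
    refine ⟨min c (1 / 2), C * (1 + R), by positivity, by positivity, fun z _ hz => ?_⟩
    rw [Real.rpow_zero, mul_one]
    have hF := norm_le_pi_norm
      ![MvPolynomial.eval z f - lam, MvPolynomial.eval z (MvPolynomial.pderiv 1 f)]
    have hF0 := hF 0
    have hF1 := hF 1
    simp only [Matrix.cons_val_zero, Matrix.cons_val_one] at hF0 hF1
    rcases le_or_gt ‖z 0‖ R with hx | hx
    · have hzy : ‖z‖ ≤ ‖z 1‖ := by
        by_contra! hlt
        refine absurd hz (not_lt.2 ((pi_norm_le_iff_of_nonneg (by positivity)).2 fun i => ?_))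
        have hRC : R ≤ C * (1 + R) := by nlinarith
        fin_cases i
        · exact hx.trans hRC
        · by_contra! h'
          have : ‖z‖ ≤ ‖z 1‖ := (pi_norm_le_iff_of_nonneg (norm_nonneg _)).2 fun i => by
            fin_cases i
            · exact (hx.trans hRC).trans h'.le
            · exact le_rfl
          exact absurd hlt (not_lt.2 this)
      have h1 := hgrow (z 0) (z 1) ((mul_le_mul_of_nonneg_left (by linarith)
        (by linarith)).trans (hz.le.trans hzy))
      rw [vecCons_apply_zero_apply_one] at h1
      have h2 : 1 ≤ ‖z 1‖ ^ n := one_le_pow₀ (le_trans (by nlinarith) (hz.le.trans hzy))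
      calc min c (1 / 2) ≤ 1 / 2 := min_le_right _ _
        _ ≤ _ := by linarith
    · obtain ⟨t, i, ht1, -, hti⟩ := h (z 0) (z 1) hx
      rw [vecCons_apply_zero_apply_one] at hti
      refine (min_le_left _ _).trans ?_
      rcases hti with hti | hti
      · exact ((le_mul_of_one_le_right hc.le (one_le_zpow₀ ht1 (hnonneg i))).trans hti).trans hF0
      · exact ((le_mul_of_one_le_right hc.le (one_le_zpow₀ ht1 (hS i))).trans hti).trans hF1
  exact le_iSup₂_of_le (f := fun (ν : ℝ) (_ : ν ∈ lojasiewiczSet _ _) => (ν : EReal)) 0 hmem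
    (by simp)

/-- The weight `|x| = |t| ^ D` on `f_y` makes up for the missing `m i ≤ D`, and it matches the loss
of one degree in the chain rule. Raising to the power `D` avoids the fractional exponent `T / D`. -/
theorem exists_zpow_le_norm_add_pow (hn : 0 < n) (hD : 0 < D)
    (hroots : ∀ᶠ t in cobounded ℂ, ∀ y : ℂ,
      MvPolynomial.eval ![t ^ D, y] f - lam = ∏ i, (y - β i t))
    (he : ∀ i j, j ≠ i → HasDegInfty (fun t => β i t - β j t) (e i j))
    (hm : ∀ i j, j ≠ i → m i ≤ e i j) (hmD : ∀ i, m i ≤ D) {T : ℤ}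
    (hT : ∀ i, T ≤ ∑ j ∈ Finset.univ.erase i, e i j + m i) :
    ∃ c R : ℝ, 0 < c ∧ ∀ x y : ℂ, R < ‖x‖ →
      c * ‖x‖ ^ T ≤ (‖MvPolynomial.eval ![x, y] f - lam‖ +
        ‖x‖ * ‖MvPolynomial.eval ![x, y] (MvPolynomial.pderiv 1 f)‖) ^ D := by
  obtain ⟨c, R, hc, hR, h⟩ := exists_norm_eval_or_norm_pderiv_ge hn hD hroots he hm
  refine ⟨c ^ D, R, by positivity, fun x y hx => ?_⟩
  obtain ⟨t, i, ht1, htx, hti⟩ := h x y hx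
  have ht0 : 0 < ‖t‖ := by linarith
  have hx' : ‖x‖ = ‖t‖ ^ D := by rw [← htx, norm_pow]
  have hbound : c * ‖t‖ ^ T ≤ ‖MvPolynomial.eval ![x, y] f - lam‖ +
        ‖x‖ * ‖MvPolynomial.eval ![x, y] (MvPolynomial.pderiv 1 f)‖ := by
    rcases hti with hti | hti
    · refine le_trans ?_ (le_add_of_nonneg_right (by positivity))
      refine le_trans ?_ hti
      gcongr
      exact hT i
    · refine le_trans ?_ (le_add_of_nonneg_left (by positivity))
      calc c * ‖t‖ ^ T ≤ c * ‖t‖ ^ (D + ∑ j ∈ Finset.univ.erase i, e i j) := by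
            gcongr
            linarith [hT i, hmD i]
        _ = ‖x‖ * (c * ‖t‖ ^ (∑ j ∈ Finset.univ.erase i, e i j)) := by
            rw [zpow_add₀ ht0.ne', zpow_natCast, hx']; ring
        _ ≤ _ := by gcongr
  calc c ^ D * ‖x‖ ^ T = (c * ‖t‖ ^ T) ^ D := by
        rw [mul_pow, hx', ← zpow_natCast (‖t‖ ^ T), ← zpow_mul, ← zpow_natCast ‖t‖ D, ← zpow_mul,
          mul_comm T]
    _ ≤ _ := by gcongr

/-- The lower bound for the degree of the gradient along curves to the fibre. -/
theorem le_degInftyMap_polyGrad_div (hf : IsMonicForm f n) (hn : 0 < n) (hD : 0 < D)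
    (hroots : ∀ᶠ t in cobounded ℂ, ∀ y : ℂ,
      MvPolynomial.eval ![t ^ D, y] f - lam = ∏ i, (y - β i t))
    (he : ∀ i j, j ≠ i → HasDegInfty (fun t => β i t - β j t) (e i j))
    (hm : ∀ i j, j ≠ i → m i ≤ e i j) (hmD : ∀ i, m i ≤ D) {T : ℤ}
    (hT : ∀ i, T ≤ ∑ j ∈ Finset.univ.erase i, e i j + m i) {Φ : ℂ → Fin 2 → ℂ}
    (hΦ : IsCurveToFiber f lam Φ) :
    (((T / D - 1 : ℝ)) : EReal) ≤ degInftyMap (fun t => polyGrad f (Φ t)) / degInftyMap Φ := by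
  obtain ⟨c, R, hc, hbound⟩ := exists_zpow_le_norm_add_pow hn hD hroots he hm hmD hT
  obtain ⟨d, hd, hΦ0, hΦ1, hdeg⟩ := hf.hasDegInfty_of_isCurveToFiber hn hΦ
  obtain ⟨hmer, -, hneg⟩ := hΦ
  have hgmer : MeromorphicAtInfty fun t => MvPolynomial.eval (Φ t) f - lam :=
    (MeromorphicAtInfty.mvPolynomial_eval f hmer).sub (MeromorphicAtInfty.const lam)
  have hgrad : ∀ i, MeromorphicAtInfty fun t => polyGrad f (Φ t) i := fun i =>
    MeromorphicAtInfty.mvPolynomial_eval _ hmer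
  have hinf : Tendsto (fun t => ‖Φ t 0‖) (cobounded ℂ) atTop := by
    refine hΦ0.isTheta.tendsto_norm_atTop_iff.2 ?_
    lift d to ℕ using hd.le
    simp only [zpow_natCast, norm_pow, Function.comp_def]
    exact (tendsto_pow_atTop (by omega)).comp tendsto_norm_cobounded_atTop
  have key : ∀ k : ℤ, (∀ i, (fun t => polyGrad f (Φ t) i) =O[cobounded ℂ] fun t => t ^ k) →
      d * T ≤ D * (k + d) := by
    intro k hk
    -- The degree `a` is negative, hence nonzero, so the derivative has degree exactly `a - 1`; the
    -- chain rule bounds it by `k + d - 1`.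
    have hg : (fun t => MvPolynomial.eval (Φ t) f - lam) =O[cobounded ℂ] fun t => t ^ (k + d) := by
      rcases hgmer.eventually_zero_or_hasDegInfty with h0 | ⟨a, ha⟩
      · exact EventuallyEq.trans_isBigO (f₂ := fun _ => (0 : ℂ)) h0 (isBigO_zero _ _)
      · have ha0 : a < 0 := by
          rw [ha.degInfty_eq] at hneg
          exact_mod_cast hneg
        have h1 := (ha.deriv_of_ne_zero ha0.ne).isTheta.2
        have h2 : deriv (fun t => MvPolynomial.eval (Φ t) f - lam) =O[cobounded ℂ]
            fun t => t ^ k * t ^ (d - 1) :=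
          EventuallyEq.trans_isBigO (eventually_deriv_eval_sub_eq f lam hmer)
            (((hk 0).mul ((hmer 0).deriv_isBigO hΦ0.isTheta.1)).add
              ((hk 1).mul ((hmer 1).deriv_isBigO hΦ1)))
        have h3 : (fun t : ℂ => t ^ k * t ^ (d - 1)) =ᶠ[cobounded ℂ] fun t => t ^ (k + (d - 1)) := by
          filter_upwards [eventually_cobounded_ne_zero] with t ht
          rw [zpow_add₀ ht]
        have h4 := zpow_isBigO_zpow_cobounded.1 (h1.trans (h2.trans_eventuallyEq h3))
        exact ha.isTheta.1.trans (zpow_isBigO_zpow_cobounded.2 (by omega))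
    have hy : (fun t => Φ t 0 * polyGrad f (Φ t) 1) =O[cobounded ℂ] fun t => t ^ (k + d) := by
      refine (hΦ0.isTheta.1.mul (hk 1)).trans_eventuallyEq ?_
      filter_upwards [eventually_cobounded_ne_zero] with t ht
      rw [add_comm, zpow_add₀ ht]
    have h1 : (fun t => Φ t 0 ^ T) =O[cobounded ℂ] fun t : ℂ => (t ^ (k + d)) ^ D := by
      refine IsBigO.trans ?_ ((hg.norm_left.add hy.norm_left).pow D)
      refine IsBigO.of_bound c⁻¹ ?_
      filter_upwards [hinf.eventually_gt_atTop R] with t ht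
      have h2 := hbound _ (Φ t 1) ht
      rw [vecCons_apply_zero_apply_one] at h2
      rw [← div_eq_inv_mul, le_div_iff₀' hc, norm_zpow, norm_mul]
      exact h2.trans (Real.le_norm_self _)
    have h2 : (fun t : ℂ => t ^ (d * T)) =O[cobounded ℂ] fun t : ℂ => t ^ ((k + d) * D) := by
      refine IsBigO.trans_eventuallyEq (g₁ := fun t : ℂ => (t ^ (k + d)) ^ D) ?_ ?_
      · refine IsBigO.trans ?_ h1
        simp only [zpow_mul]
        exact (hΦ0.isTheta.zpow T).2
      · filter_upwards with t
        rw [zpow_mul, zpow_natCast]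
    linarith [zpow_isBigO_zpow_cobounded.1 h2]
  have hD' : (0 : ℝ) < D := by exact_mod_cast hD
  have hd' : (0 : ℝ) < d := by exact_mod_cast hd
  rw [hdeg, EReal.le_div_iff_mul_le (by exact_mod_cast hd') (EReal.coe_ne_top _)]
  by_contra! hlt
  obtain ⟨k, hk1, hk2⟩ : ∃ k : ℤ, degInftyMap (fun t => polyGrad f (Φ t)) ≤ ((k : ℝ) : EReal) ∧
      D * (k + d) < d * T := by
    have hcomp : ∀ i, degInfty (fun t => polyGrad f (Φ t) i) = ⊥ ∨
        ∃ k : ℤ, degInfty (fun t => polyGrad f (Φ t) i) = ((k : ℝ) : EReal) := fun i => by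
      rcases (hgrad i).eventually_zero_or_hasDegInfty with h0 | ⟨a, ha⟩
      · exact Or.inl (degInfty_eq_bot_iff.2 h0)
      · exact Or.inr ⟨a, ha.degInfty_eq⟩
    obtain ⟨i, -, hi⟩ := Finset.exists_mem_eq_sup (Finset.univ : Finset (Fin 2))
      Finset.univ_nonempty fun i => degInfty fun t => polyGrad f (Φ t) i
    change degInftyMap (fun t => polyGrad f (Φ t)) = _ at hi
    rw [hi] at hlt ⊢
    rcases hcomp i with h0 | ⟨k, hk⟩
    -- A gradient of degree `-∞` lies below every integer; this one makes `D (k + d) < -|d T|`.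
    · refine ⟨-(|d * T| + 1) - d, by simp [h0], ?_⟩
      have := neg_abs_le (d * T)
      have hD1 : (1 : ℤ) ≤ D := by exact_mod_cast hD
      nlinarith [abs_nonneg (d * T)]
    · refine ⟨k, hk.le, ?_⟩
      rw [hk] at hlt
      have h1 : (k : ℝ) < (T / D - 1) * d := by exact_mod_cast hlt
      have h2 : (D : ℝ) * (k + d) < d * T := by
        have h3 := mul_lt_mul_of_pos_left h1 hD'
        have h4 : (D : ℝ) * ((T / D - 1) * d) = d * T - D * d := by field_simp
        linarith
      exact_mod_cast h2
  refine absurd (key k fun i => ?_) (not_le.2 hk2)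
  exact (hgrad i).degInfty_le_iff.1 ((Finset.le_sup (f := fun i => degInfty fun t =>
    polyGrad f (Φ t) i) (Finset.mem_univ i)).trans hk1)

end PointwiseBounds

/-! ### Critical points and their continuation. -/

/-- A polynomial `X * Q` with a simple root at `0` and some other root has a critical point with
nonzero critical value. -/
theorem Polynomial.exists_eval_derivative_X_mul_eq_zero {Q : ℂ[X]} (h0 : Q.eval 0 ≠ 0)
    (hdeg : 0 < Q.natDegree) :
    ∃ s, (derivative (X * Q)).eval s = 0 ∧ (X * Q).eval s ≠ 0 := by
  by_contra! hno
  have hQ0 : Q ≠ 0 := by rintro rfl; simp at hdeg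
  have hP0 : X * Q ≠ 0 := mul_ne_zero X_ne_zero hQ0
  set R := derivative (X * Q) with hR
  have hR0 : R ≠ 0 := fun h => h0 (by simpa [hR] using congrArg (eval 0) h)
  have hdegR : R.natDegree = Q.natDegree := by
    rw [hR, natDegree_derivative, natDegree_X_mul hQ0, Nat.add_sub_cancel]
  -- If every critical point is a zero of `X * Q`, each root of `R` is nonzero and has multiplicity
  -- one less in `R` than in `Q`. Equal degrees then give `R = a Q`; comparison at `0` gives `a =
  -- 1`, so `X * Q' = 0`.
  have hdvd : R ∣ Q := by
    rw [(IsAlgClosed.splits R).dvd_iff_roots_le_roots hR0 hQ0, Multiset.le_iff_count]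
    intro r
    rw [count_roots, count_roots]
    by_cases hr : R.IsRoot r
    · have hr1 : (X * Q).IsRoot r := hno r hr
      have hmult : R.rootMultiplicity r = (X * Q).rootMultiplicity r - 1 :=
        derivative_rootMultiplicity_of_root hr1
      have hrne : r ≠ 0 := by
        rintro rfl
        apply h0
        simpa [hR, IsRoot] using hr
      rw [hmult, rootMultiplicity_mul hP0, rootMultiplicity_eq_zero (p := X) (by simpa using hrne)]
      omega
    · rw [rootMultiplicity_eq_zero hr]
      exact Nat.zero_le _
  obtain ⟨u, hu⟩ := hdvd
  have hu0 : u ≠ 0 := by rintro rfl; exact hQ0 (by simpa using hu)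
  have hudeg : u.natDegree = 0 := by
    have := congrArg natDegree hu
    rw [natDegree_mul hR0 hu0, hdegR] at this
    omega
  obtain ⟨a, rfl⟩ : ∃ a, u = C a := ⟨_, eq_C_of_natDegree_eq_zero hudeg⟩
  have hRe : R = Q + X * derivative Q := by rw [hR, derivative_mul, derivative_X, one_mul]
  have ha : a = 1 := by
    have h1 := congrArg (eval 0) hu
    rw [hRe] at h1
    simp only [eval_mul, eval_add, eval_X, zero_mul, add_zero, eval_C] at h1
    exact mul_left_cancel₀ h0 (by rw [← h1, mul_one])
  have hder : derivative Q = 0 := by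
    rw [ha, C_1, mul_one, hRe] at hu
    have h1 : X * derivative Q = 0 := by
      calc X * derivative Q = (Q + X * derivative Q) - Q := by ring
        _ = 0 := by rw [← hu, sub_self]
    exact (mul_eq_zero.1 h1).resolve_left X_ne_zero
  exact hdeg.ne' (derivative_eq_zero.1 hder)

namespace AnalyticPolyFamily

variable {H K : ℂ → ℂ[X]}

theorem add (hH : AnalyticPolyFamily H) (hK : AnalyticPolyFamily K) :
    AnalyticPolyFamily fun τ => H τ + K τ := by
  obtain ⟨⟨d, hd⟩, h⟩ := hH
  obtain ⟨⟨e, he⟩, k⟩ := hK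
  refine ⟨⟨max d e, fun τ => (natDegree_add_le _ _).trans (max_le_max (hd τ) (he τ))⟩, fun i => ?_⟩
  simp only [coeff_add]
  exact (h i).add (k i)

theorem comp_pow (hH : AnalyticPolyFamily H) {N : ℕ} (hN : 0 < N) :
    AnalyticPolyFamily fun u => H (u ^ N) := by
  obtain ⟨⟨d, hd⟩, h⟩ := hH
  exact ⟨⟨d, fun u => hd _⟩, fun k => AnalyticAt.fun_comp (g := fun τ => (H τ).coeff k)
    (by simpa [hN.ne'] using h k) (analyticAt_id.pow N)⟩

/-- A critical point of `P₀` extends to a Puiseux branch of critical points of `P_τ`. -/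
theorem exists_puiseux_root_derivative (hH : AnalyticPolyFamily H) {s₀ : ℂ}
    (hne : Polynomial.derivative (H 0) ≠ 0) (h0 : (Polynomial.derivative (H 0)).eval s₀ = 0) :
    ∃ (N : ℕ) (σ : ℂ → ℂ), 0 < N ∧ AnalyticAt ℂ σ 0 ∧ σ 0 = s₀ ∧
      ∀ᶠ u in 𝓝 0, (Polynomial.derivative (H (u ^ N))).eval (σ u) = 0 := by
  have hT0 : Polynomial.taylor s₀ (Polynomial.derivative (H 0)) ≠ 0 := by
    rwa [Ne, taylor_eq_zero]
  have hpos : 0 < (Polynomial.taylor s₀ (Polynomial.derivative (H 0))).natTrailingDegree := by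
    rw [Nat.pos_iff_ne_zero, Ne, natTrailingDegree_eq_zero]
    rintro (h | h)
    · exact hT0 h
    · rw [taylor_coeff_zero] at h
      exact h h0
  obtain ⟨N, s, hN, hs, hs0, h⟩ := (hH.derivative.taylor (σ := fun _ => s₀)
    analyticAt_const).exists_puiseux_root hpos
    (fun k hk => coeff_eq_zero_of_lt_natTrailingDegree hk) (mt trailingCoeff_eq_zero.1 hT0)
  refine ⟨N, fun u => s u + s₀, hN, hs.add analyticAt_const, by simp [hs0], ?_⟩
  filter_upwards [h] with u hu
  rwa [taylor_eval] at hu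

end AnalyticPolyFamily

theorem zpow_finsetSum {ι : Type*} {z : ℂ} (hz : z ≠ 0) (s : Finset ι) (e : ι → ℤ) :
    z ^ (∑ j ∈ s, e j) = ∏ j ∈ s, z ^ (e j) := by
  classical
  induction s using Finset.induction_on with
  | empty => simp
  | insert a s ha ih => rw [Finset.sum_insert ha, Finset.prod_insert ha, zpow_add₀ hz, ih]

/-! ### Polar curves attaining the bound. -/

section UpperBound

variable {f : MvPolynomial (Fin 2) ℂ} {n : ℕ} {lam : ℂ} {D : ℕ} {β : Fin n → ℂ → ℂ}

/-- In the coordinate `s` with `y = βᵢ + t ^ m * s`, where `m` is the least degree of the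
differences `βᵢ - βⱼ`, the polynomial `f - lam` is a power of `t` times a family of polynomials
analytic in `t⁻¹`. -/
theorem exists_analyticPolyFamily_cluster
    (hroots : ∀ᶠ t in cobounded ℂ, ∀ y : ℂ,
      MvPolynomial.eval ![t ^ D, y] f - lam = ∏ i, (y - β i t)) {i : Fin n} {e : Fin n → ℤ} {m : ℤ}
    (he : ∀ j, j ≠ i → HasDegInfty (fun t => β i t - β j t) (e j))
    (hm : ∀ j, j ≠ i → m ≤ e j) (hm' : ∃ j, j ≠ i ∧ e j = m) :
    ∃ P : ℂ → ℂ[X], AnalyticPolyFamily P ∧ derivative (P 0) ≠ 0 ∧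
      (∃ s₀, (derivative (P 0)).eval s₀ = 0 ∧ (P 0).eval s₀ ≠ 0) ∧
      ∀ᶠ t in cobounded ℂ, ∀ s, MvPolynomial.eval ![t ^ D, β i t + t ^ m * s] f - lam =
        t ^ (∑ j ∈ Finset.univ.erase i, e j + m) * (P t⁻¹).eval s := by
  have hg : ∀ j, ∃ g : ℂ → ℂ, AnalyticAt ℂ g 0 ∧ g 0 ≠ 0 ∧
      (j ≠ i → ∀ᶠ t in cobounded ℂ, β i t - β j t = t ^ (e j) * g t⁻¹) := by
    intro j
    by_cases hj : j = i
    · exact ⟨fun _ => 1, analyticAt_const, one_ne_zero, fun h => (h hj).elim⟩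
    · obtain ⟨g, h1, h2, h3⟩ := he j hj
      exact ⟨g, h1, h2, fun _ => h3⟩
  choose g hga hg0 hg using hg
  -- With `τ = t⁻¹`, `y - β j = t ^ e j * (τ ^ (e j - m) * s + g j τ)`, and `m ≤ e j` makes `toNat`
  -- exact. At `τ = 0` only the factors with `e j = m` keep positive degree; `hm'` supplies one.
  set Q : ℂ → ℂ[X] := fun τ => ∏ j ∈ Finset.univ.erase i,
    (C (τ ^ (e j - m).toNat) * X + C (g j τ)) with hQ
  have hQfam : AnalyticPolyFamily Q := AnalyticPolyFamily.prod _ fun j _ =>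
    ((AnalyticPolyFamily.C_of_analyticAt (analyticAt_id.pow _)).mul
      (AnalyticPolyFamily.const X)).add (AnalyticPolyFamily.C_of_analyticAt (hga j))
  have hQeval : (Q 0).eval 0 ≠ 0 := by
    simp only [hQ, eval_prod, eval_add, eval_mul, eval_C, eval_X, mul_zero, zero_add]
    exact Finset.prod_ne_zero_iff.2 fun j _ => hg0 j
  have hQdeg : 0 < (Q 0).natDegree := by
    obtain ⟨j, hj, hjm⟩ := hm'
    have hne : ∀ j ∈ Finset.univ.erase i,
        (C ((0 : ℂ) ^ (e j - m).toNat) * X + C (g j 0) : ℂ[X]) ≠ 0 := fun j _ h =>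
      hg0 j (by simpa using congrArg (eval 0) h)
    simp only [hQ]
    rw [natDegree_prod _ _ hne]
    refine lt_of_lt_of_le ?_ (Finset.single_le_sum (fun _ _ => Nat.zero_le _)
      (Finset.mem_erase.2 ⟨hj, Finset.mem_univ j⟩))
    rw [hjm, sub_self, Int.toNat_zero, pow_zero, C_1, one_mul, natDegree_X_add_C]
    exact one_pos
  refine ⟨fun τ => X * Q τ, (AnalyticPolyFamily.const X).mul hQfam,
    fun h => hQeval (by simpa using congrArg (eval 0) h),
    exists_eval_derivative_X_mul_eq_zero hQeval hQdeg, ?_⟩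
  have hev : ∀ᶠ t in cobounded ℂ, ∀ j, j ≠ i → β i t - β j t = t ^ (e j) * g j t⁻¹ := by
    rw [eventually_all]
    intro j
    by_cases hj : j = i
    · exact Eventually.of_forall fun t h => (h hj).elim
    · filter_upwards [hg j hj] with t ht _ using ht
  filter_upwards [hroots, hev, eventually_cobounded_ne_zero] with t h1 h2 ht s
  rw [h1, ← Finset.mul_prod_erase _ _ (Finset.mem_univ i), zpow_add₀ ht, zpow_finsetSum ht]
  simp only [hQ, eval_mul, eval_X, eval_prod, eval_add, eval_C]
  have hfac : ∀ j ∈ Finset.univ.erase i, β i t + t ^ m * s - β j t =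
      t ^ (e j) * (t⁻¹ ^ (e j - m).toNat * s + g j t⁻¹) := by
    intro j hj
    have hji := Finset.ne_of_mem_erase hj
    have h3 : t ^ (e j) * t⁻¹ ^ (e j - m).toNat = t ^ m := by
      rw [← zpow_natCast, Int.toNat_of_nonneg (sub_nonneg.2 (hm j hji)), inv_zpow, ← zpow_neg,
        ← zpow_add₀ ht]
      congr 1; ring
    rw [mul_add, ← mul_assoc, h3, ← h2 j hji]
    ring
  rw [Finset.prod_congr rfl hfac, Finset.prod_mul_distrib]
  ring

/-- On a polar curve whose first component is a power of `t`, the other partial derivative is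
determined by the derivative of `f` along the curve. -/
theorem eventually_polyGrad_zero_mul_eq (f : MvPolynomial (Fin 2) ℂ) (lam : ℂ) {ψ : ℂ → ℂ}
    (hψ : MeromorphicAtInfty ψ) (q : ℕ)
    (h1 : ∀ᶠ t in cobounded ℂ, polyGrad f ![t ^ q, ψ t] 1 = 0) :
    ∀ᶠ t in cobounded ℂ, polyGrad f ![t ^ q, ψ t] 0 * (q * t ^ (q - 1)) =
      deriv (fun t => MvPolynomial.eval ![t ^ q, ψ t] f - lam) t := by
  have hmer : ∀ i, MeromorphicAtInfty fun t => ![t ^ q, ψ t] i := by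
    intro i
    fin_cases i
    · simpa using MeromorphicAtInfty.zpow (q : ℤ)
    · exact hψ
  filter_upwards [h1, eventually_deriv_eval_sub_eq f lam hmer] with t ht1 ht
  rw [ht, ht1]
  simp

/-- A double root makes the gradient vanish identically along the root. -/
theorem exists_curve_of_eventually_eq (hD : 0 < D) (hβ : ∀ i, MeromorphicAtInfty (β i))
    (hroots : ∀ᶠ t in cobounded ℂ, ∀ y : ℂ,
      MvPolynomial.eval ![t ^ D, y] f - lam = ∏ i, (y - β i t)) {i j : Fin n} (hij : j ≠ i)
    (heq : ∀ᶠ t in cobounded ℂ, β i t - β j t = 0) :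
    ∃ Φ, IsCurveToFiber f lam Φ ∧ degInftyMap (fun t => polyGrad f (Φ t)) = ⊥ := by
  have hX : HasDegInfty (fun t => t ^ D) D :=
    ⟨fun _ => 1, analyticAt_const, one_ne_zero, by simp⟩
  have hF : ∀ᶠ t in cobounded ℂ, MvPolynomial.eval ![t ^ D, β i t] f - lam = 0 := by
    filter_upwards [hroots] with t ht
    rw [ht, Finset.prod_eq_zero (Finset.mem_univ i) (sub_self _)]
  -- Every summand of `f_y` omits one factor and so keeps at least one of the two equal vanishing
  -- factors.
  have h1 : ∀ᶠ t in cobounded ℂ, polyGrad f ![t ^ D, β i t] 1 = 0 := by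
    filter_upwards [hroots, heq] with t ht hij0
    refine (eval_pderiv_one_eq_sum ht _).trans (Finset.sum_eq_zero fun k _ => ?_)
    by_cases hk : k = i
    · exact Finset.prod_eq_zero (Finset.mem_erase.2 ⟨hk ▸ hij, Finset.mem_univ j⟩) hij0
    · exact Finset.prod_eq_zero (Finset.mem_erase.2 ⟨Ne.symm hk, Finset.mem_univ i⟩) (sub_self _)
  have h0 : ∀ᶠ t in cobounded ℂ, polyGrad f ![t ^ D, β i t] 0 = 0 := by
    filter_upwards [eventually_polyGrad_zero_mul_eq f lam (hβ i) D h1,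
      eventually_cobounded_eventually_nhds hF, eventually_cobounded_ne_zero] with t ht hloc ht0
    rw [EventuallyEq.deriv_eq (f := fun _ => (0 : ℂ)) hloc, deriv_const] at ht
    exact (mul_eq_zero.1 ht).resolve_right
      (mul_ne_zero (by exact_mod_cast hD.ne') (pow_ne_zero _ ht0))
  refine ⟨fun t => ![t ^ D, β i t], ⟨fun k => ?_, ?_, ?_⟩, ?_⟩
  · fin_cases k
    · exact hX.meromorphicAtInfty
    · exact hβ i
  · refine lt_of_lt_of_le ?_ (Finset.le_sup (f := fun k => degInfty fun t => ![t ^ D, β i t] k)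
      (Finset.mem_univ 0))
    change 0 < degInfty (fun t => t ^ D)
    rw [hX.degInfty_eq]
    exact_mod_cast hD
  · rw [degInfty_eq_bot_iff.2 hF]
    exact EReal.bot_lt_zero
  · refine le_bot_iff.1 (Finset.sup_le fun k _ => le_bot_iff.2 (degInfty_eq_bot_iff.2 ?_))
    fin_cases k
    · exact h0
    · exact h1

/-- A polar curve near the root `βᵢ` realizing the upper bound. -/
theorem exists_curve_degInftyMap_polyGrad_div_le (hf : IsMonicForm f n) (hn : 0 < n) (hD : 0 < D)
    (hβ : ∀ i, MeromorphicAtInfty (β i))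
    (hroots : ∀ᶠ t in cobounded ℂ, ∀ y : ℂ,
      MvPolynomial.eval ![t ^ D, y] f - lam = ∏ i, (y - β i t)) {i : Fin n} {e : Fin n → ℤ} {m : ℤ}
    (he : ∀ j, j ≠ i → HasDegInfty (fun t => β i t - β j t) (e j))
    (hm : ∀ j, j ≠ i → m ≤ e j) (hm' : ∃ j, j ≠ i ∧ e j = m)
    (hneg : ∑ j ∈ Finset.univ.erase i, e j + m < 0) :
    ∃ Φ, IsCurveToFiber f lam Φ ∧
      degInftyMap (fun t => polyGrad f (Φ t)) / degInftyMap Φ ≤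
        ((((∑ j ∈ Finset.univ.erase i, e j + m : ℤ) : ℝ) / D - 1 : ℝ) : EReal) := by
  set T := ∑ j ∈ Finset.univ.erase i, e j + m with hT
  obtain ⟨P, hP, hP', ⟨s₀, hs₀, hs₀'⟩, hcoord⟩ := exists_analyticPolyFamily_cluster hroots he hm hm'
  rw [← hT] at hcoord
  obtain ⟨N, σ, hN, hσ, hσ0, hcrit⟩ := hP.exists_puiseux_root_derivative hP' hs₀
  have hNpow := tendsto_pow_cobounded_cobounded (α := ℂ) hN.ne'
  -- The parameter is `v` with `t = v ^ N`, which makes the Puiseux branch `s = σ v⁻¹`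
  -- single-valued.
  set ψ : ℂ → ℂ := fun v => β i (v ^ N) + v ^ (N * m) * σ v⁻¹ with hψ
  have hψmer : MeromorphicAtInfty ψ := ((hβ i).comp_pow hN).add
    ((MeromorphicAtInfty.zpow _).mul (MeromorphicAtInfty.of_analyticAt hσ))
  set Φ : ℂ → Fin 2 → ℂ := fun v => ![v ^ (N * D), ψ v] with hΦ
  have hX : HasDegInfty (fun t => t ^ (N * D)) ((N * D : ℕ) : ℤ) :=
    ⟨fun _ => 1, analyticAt_const, one_ne_zero, by simp only [zpow_natCast, mul_one, eventually_true]⟩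
  -- The degree is exactly `N * T` because the critical value `P 0` at `s₀` is nonzero.
  have hF : HasDegInfty (fun v => MvPolynomial.eval (Φ v) f - lam) (N * T) := by
    refine ⟨fun u => (P (u ^ N)).eval (σ u), (hP.comp_pow hN).analyticAt_eval hσ,
      by simpa [hN.ne', hσ0] using hs₀', ?_⟩
    filter_upwards [hNpow.eventually hcoord] with v hv
    have := hv (σ v⁻¹)
    rwa [← pow_mul, ← zpow_natCast v N, ← zpow_mul, ← zpow_mul, zpow_natCast, ← inv_pow] at this
  have h1 : ∀ᶠ v in cobounded ℂ, polyGrad f (Φ v) 1 = 0 := by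
    filter_upwards [hNpow.eventually hcoord, tendsto_inv₀_cobounded.eventually hcrit,
      eventually_cobounded_ne_zero] with v hv hc hv0
    have hd1 : HasDerivAt (fun s => MvPolynomial.eval ![(v ^ N) ^ D, β i (v ^ N) + (v ^ N) ^ m * s] f)
        (∑ k, MvPolynomial.eval ![(v ^ N) ^ D, β i (v ^ N) + (v ^ N) ^ m * σ v⁻¹]
          (MvPolynomial.pderiv k f) * ![0, (v ^ N) ^ m] k) (σ v⁻¹) := by
      refine MvPolynomial.hasDerivAt_eval_comp f fun k => ?_
      fin_cases k
      · exact hasDerivAt_const _ _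
      · simpa using ((hasDerivAt_id (σ v⁻¹)).const_mul ((v ^ N) ^ m)).const_add (β i (v ^ N))
    have hd2 := ((P (v ^ N)⁻¹).hasDerivAt (σ v⁻¹)).const_mul ((v ^ N) ^ T)
    have hd3 := (hd1.sub_const lam).unique (hd2.congr_of_eventuallyEq (Eventually.of_forall hv))
    rw [← inv_pow, hc, mul_zero, Fin.sum_univ_two] at hd3
    simp only [Matrix.cons_val_zero, Matrix.cons_val_one, mul_zero, zero_add] at hd3
    have hd4 := (mul_eq_zero.1 hd3).resolve_right (zpow_ne_zero _ (pow_ne_zero _ hv0))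
    rw [← pow_mul, ← zpow_natCast v N, ← zpow_mul, zpow_natCast] at hd4
    exact hd4
  have hmer : ∀ k, MeromorphicAtInfty fun v => Φ v k := by
    intro k
    fin_cases k
    · exact hX.meromorphicAtInfty
    · exact hψmer
  have hND : 0 < N * D := Nat.mul_pos hN hD
  have hNT : (N : ℤ) * T < 0 := mul_neg_of_pos_of_neg (by exact_mod_cast hN) hneg
  have hcurve : IsCurveToFiber f lam Φ := by
    refine ⟨hmer, ?_, ?_⟩
    · refine lt_of_lt_of_le ?_ (Finset.le_sup (f := fun k => degInfty fun t => Φ t k)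
        (Finset.mem_univ 0))
      change 0 < degInfty (fun t => t ^ (N * D))
      rw [hX.degInfty_eq]
      exact_mod_cast hND
    · rw [hF.degInfty_eq]
      exact_mod_cast hNT
  obtain ⟨d, hd, hd0, -, hdeg⟩ := hf.hasDegInfty_of_isCurveToFiber hn hcurve
  have hdND : d = (N * D : ℕ) := hd0.unique hX
  -- Since `f_y = 0` on the curve, `f_x` is the derivative of `f - lam` divided by that of `v ^ (N *
  -- D)`, of degree `(N T - 1) - (N D - 1)`.
  have h0 : (fun v => polyGrad f (Φ v) 0) =O[cobounded ℂ] fun v => v ^ (N * T - (N * D : ℕ)) := by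
    have h2 := (hF.deriv_of_ne_zero hNT.ne).isTheta.1
    have h3 := (h2.mul (isBigO_refl (fun v : ℂ => v ^ (-((N * D : ℕ) - 1 : ℤ))) _)).const_mul_left
      (((N * D : ℕ) : ℂ)⁻¹)
    refine IsBigO.congr' h3 ?_ ?_
    · filter_upwards [eventually_polyGrad_zero_mul_eq f lam hψmer (N * D) h1,
        eventually_cobounded_ne_zero] with v hv hv0
      have hz : v ^ (-((N * D : ℕ) - 1 : ℤ)) = (v ^ (N * D - 1))⁻¹ := by
        rw [zpow_neg, ← zpow_natCast v (N * D - 1), Nat.cast_pred hND]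
      have hq : ((N * D : ℕ) : ℂ) ≠ 0 := by exact_mod_cast hND.ne'
      have hvp : v ^ (N * D - 1) ≠ 0 := pow_ne_zero _ hv0
      rw [hz]
      change _ * (deriv (fun t => MvPolynomial.eval ![t ^ (N * D), ψ t] f - lam) v * _) =
        polyGrad f ![v ^ (N * D), ψ v] 0
      rw [← hv]
      field_simp
    · filter_upwards [eventually_cobounded_ne_zero] with v hv0
      rw [← zpow_add₀ hv0]
      congr 1; ring
  have hgrad : degInftyMap (fun v => polyGrad f (Φ v)) ≤
      (((N * T - (N * D : ℕ) : ℤ) : ℝ) : EReal) := by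
    refine Finset.sup_le fun k _ => ?_
    fin_cases k
    · exact (MeromorphicAtInfty.mvPolynomial_eval _ hmer).degInfty_le_iff.2 h0
    · exact (degInfty_eq_bot_iff.2 h1).trans_le bot_le
  refine ⟨Φ, hcurve, ?_⟩
  have hND' : (0 : ℝ) < (N * D : ℕ) := by exact_mod_cast hND
  rw [hdeg, hdND, EReal.div_le_iff_le_mul (by exact_mod_cast hND') (EReal.coe_ne_top _)]
  refine hgrad.trans (le_of_eq ?_)
  rw [← EReal.coe_mul]
  congr 1
  push_cast
  have : (D : ℝ) ≠ 0 := by exact_mod_cast hD.ne'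
  field_simp

end UpperBound

/-! ### The formula for the exponent. -/

theorem EReal.sum_eq_bot {ι : Type*} {s : Finset ι} {g : ι → EReal} {j : ι} (hj : j ∈ s)
    (h : g j = ⊥) : ∑ k ∈ s, g k = ⊥ := by
  classical
  rw [← Finset.add_sum_erase s g hj, h, EReal.bot_add]

theorem EReal.sum_intCast {ι : Type*} (s : Finset ι) (g : ι → ℤ) :
    ∑ k ∈ s, (((g k : ℤ) : ℝ) : EReal) = (((∑ k ∈ s, g k : ℤ) : ℝ) : EReal) := by
  classical
  induction s using Finset.induction_on with
  | empty => simp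
  | insert a s ha ih => rw [Finset.sum_insert ha, Finset.sum_insert ha, ih]; push_cast; rfl

theorem corollary3p6 (f : MvPolynomial (Fin 2) ℂ) (n : ℕ) (hn : 1 < n) (hf : IsMonicForm f n)
    (lam : ℂ)
    (hneg : lojasiewiczExponent
      (fun z => ![MvPolynomial.eval z f - lam, MvPolynomial.eval z (MvPolynomial.pderiv 1 f)])
      Set.univ < 0)
    (D : ℕ) (hD : 0 < D) (β : Fin n → ℂ → ℂ) (hβ : ∀ i, MeromorphicAtInfty (β i))
    (hroots : ∀ᶠ t in Bornology.cobounded ℂ, ∀ y : ℂ,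
      MvPolynomial.eval ![t ^ D, y] f - lam = ∏ i, (y - β i t)) :
    lojasiewiczNearFiber f lam + 1 =
      ((1 / (D : ℝ) : ℝ) : EReal) *
        Finset.univ.inf fun i : Fin n =>
          (∑ j ∈ Finset.univ.erase i, degInfty (fun t => β i t - β j t)) +
            (Finset.univ.erase i).inf fun j => degInfty (fun t => β i t - β j t) := by
  have hn0 : 0 < n := by omega
  have hD' : (0 : ℝ) < D := by exact_mod_cast hD
  by_cases hdouble : ∃ i j, j ≠ i ∧ ∀ᶠ t in cobounded ℂ, β i t - β j t = 0
  · obtain ⟨i, j, hij, heq⟩ := hdouble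
    obtain ⟨Φ, hΦ, hbot⟩ := exists_curve_of_eventually_eq hD hβ hroots hij heq
    obtain ⟨d, hd, -, -, hdeg⟩ := hf.hasDegInfty_of_isCurveToFiber hn0 hΦ
    have hL : lojasiewiczNearFiber f lam = ⊥ := by
      refine le_bot_iff.1 ((iInf₂_le Φ hΦ).trans ?_)
      rw [hbot, hdeg, EReal.bot_div_of_pos_ne_top (by exact_mod_cast hd) (EReal.coe_ne_top _)]
    have hinf : (Finset.univ.inf fun i : Fin n =>
          (∑ j ∈ Finset.univ.erase i, degInfty (fun t => β i t - β j t)) +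
            (Finset.univ.erase i).inf fun j => degInfty (fun t => β i t - β j t)) = ⊥ := by
      refine le_bot_iff.1 ((Finset.inf_le (Finset.mem_univ i)).trans ?_)
      rw [EReal.sum_eq_bot (Finset.mem_erase.2 ⟨hij, Finset.mem_univ j⟩)
        (degInfty_eq_bot_iff.2 heq), EReal.bot_add]
    rw [hL, hinf, EReal.bot_add, EReal.coe_mul_bot_of_pos (by positivity)]
  push Not at hdouble
  have hexists : ∀ i j, ∃ e : ℤ, j ≠ i → HasDegInfty (fun t => β i t - β j t) e := by
    intro i j
    by_cases hij : j = i
    · exact ⟨0, fun h => (h hij).elim⟩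
    · rcases ((hβ i).sub (hβ j)).eventually_zero_or_hasDegInfty with h | ⟨e, he⟩
      · exact absurd h (by simpa using hdouble i j hij)
      · exact ⟨e, fun _ => he⟩
  choose e he using hexists
  have hmin : ∀ i, ∃ j, j ≠ i ∧ ∀ k, k ≠ i → e i j ≤ e i k := by
    intro i
    have hne : (Finset.univ.erase i).Nonempty := by
      rw [← Finset.card_pos, Finset.card_erase_of_mem (Finset.mem_univ i), Finset.card_univ,
        Fintype.card_fin]
      omega
    obtain ⟨j, hj, h⟩ := (Finset.univ.erase i).exists_min_image (e i) hne
    exact ⟨j, Finset.ne_of_mem_erase hj, fun k hk => h k (Finset.mem_erase.2 ⟨hk, Finset.mem_univ k⟩)⟩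
  choose l hl hlmin using hmin
  set m : Fin n → ℤ := fun i => e i (l i) with hm
  set S : Fin n → ℤ := fun i => ∑ j ∈ Finset.univ.erase i, e i j + m i with hS
  have : Nonempty (Fin n) := ⟨⟨0, hn0⟩⟩
  obtain ⟨i₀, hi₀⟩ := Finite.exists_min S
  -- The hypothesis on `(f - lam, f_y)` enters only here; negativity makes the polar curve lead to
  -- the fibre.
  have hSneg : S i₀ < 0 := by
    by_contra! h
    exact absurd hneg (not_lt.2 (lojasiewiczExponent_nonneg hf hn hD hroots he hlmin
      fun i => h.trans (hi₀ i)))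
  have hmD : ∀ i, m i ≤ D := fun i => zpow_isBigO_zpow_cobounded.1
    ((he i (l i) (hl i)).isTheta.2.trans
      ((hf.roots_isBigO hn0 hroots i).sub (hf.roots_isBigO hn0 hroots (l i))))
  have hterm : ∀ i, (∑ j ∈ Finset.univ.erase i, degInfty (fun t => β i t - β j t)) +
      ((Finset.univ.erase i).inf fun j => degInfty (fun t => β i t - β j t)) =
        (((S i : ℤ) : ℝ) : EReal) := by
    intro i
    have hdeg : ∀ j ∈ Finset.univ.erase i,
        degInfty (fun t => β i t - β j t) = (((e i j : ℤ) : ℝ) : EReal) :=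
      fun j hj => (he i j (Finset.ne_of_mem_erase hj)).degInfty_eq
    have hinf : ((Finset.univ.erase i).inf fun j => degInfty (fun t => β i t - β j t)) =
        (((m i : ℤ) : ℝ) : EReal) := by
      have hli : l i ∈ Finset.univ.erase i := Finset.mem_erase.2 ⟨hl i, Finset.mem_univ _⟩
      refine le_antisymm ((Finset.inf_le hli).trans (hdeg _ hli).le) (Finset.le_inf fun j hj => ?_)
      rw [hdeg j hj]
      exact_mod_cast hlmin i j (Finset.ne_of_mem_erase hj)
    rw [hinf, Finset.sum_congr rfl hdeg, EReal.sum_intCast, hS]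
    push_cast
    rfl
  have hRHS : (Finset.univ.inf fun i : Fin n =>
      (∑ j ∈ Finset.univ.erase i, degInfty (fun t => β i t - β j t)) +
        (Finset.univ.erase i).inf fun j => degInfty (fun t => β i t - β j t)) =
      (((S i₀ : ℤ) : ℝ) : EReal) := by
    refine le_antisymm ((Finset.inf_le (Finset.mem_univ i₀)).trans (hterm i₀).le)
      (Finset.le_inf fun i _ => ?_)
    rw [hterm]
    exact_mod_cast hi₀ i
  have hL : lojasiewiczNearFiber f lam = ((S i₀ / D - 1 : ℝ) : EReal) := by
    refine le_antisymm ?_ (le_iInf₂ fun Φ hΦ =>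
      le_degInftyMap_polyGrad_div hf hn0 hD hroots he hlmin hmD hi₀ hΦ)
    obtain ⟨Φ, hΦ, h⟩ := exists_curve_degInftyMap_polyGrad_div_le hf hn0 hD hβ hroots (he i₀)
      (hlmin i₀) ⟨l i₀, hl i₀, rfl⟩ hSneg
    exact (iInf₂_le Φ hΦ).trans h
  rw [hRHS, hL, ← EReal.coe_mul, ← EReal.coe_one, ← EReal.coe_add]
  congr 1
  ring
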